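/- Let $K$ be a finite field, $R$ a finite dimensional (unital, associative) $K$-algebra, and $\{M_n\}_{n\ge 1}$ a sequence of nonzero finitely generated left $R$-modules. For a $k\times l$ matrix $A$ over $R$, viewed as a $K$-linear map $M_n^l\to M_n^k$, put $\mathrm{rk}_{M_n}(A)=\mathrm{rank}(A)/\dim_K(M_n)$. Suppose that the sequence is * convergent: $\lim_{n\to\infty}\mathrm{rk}_{M_n}(A)$ exists for every finite matrix $A$ over $R$; and * hyperfinite: for every $\epsilon>0$ there are finitely many finitely generated $R$-modules $N_1,\dots,N_t$ such that for every $n$ there are a submodule $P_n\subseteq M_n$ with $\dim_K(P_n)\ge(1-\epsilon)\dim_K(M_n)$ and non-negative integers $\alpha_1,\dots,\alpha_t$ with $P_n\cong\bigoplus_{i=1}^t N_i^{\alpha_i}$. Let $M_K$ be von Neumann's continuous algebra, that is, the completion of the direct limit of the diagonal embeddings $K\to \mathrm{Mat}_{2\times 2}(K)\to \mathrm{Mat}_{4\times 4}(K)\to \mathrm{Mat}_{8\times 8}(K)\to\cdots$ in the metric $d(a,b)=\mathrm{rank}(a-b)$, where rank is the normalized rank; the rank of finite matrices over $M_K$ is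 obtained by continuous extension and is denoted by $\mathrm{rank}_{M_K}$. 1. Let $\omega$ be a non-principal ultrafilter on the natural numbers with $\lim_\omega \dim_K(M_n)=\infty$. Let $\mathrm{Mat}^{\mathcal M}_\omega$ be the continuous ultraproduct, that is, the quotient of $\prod_n \mathrm{End}_K(M_n)$ by the ideal of the sequences $(a_n)$ with $\lim_\omega \mathrm{rank}(a_n)/\dim_K(M_n)=0$, with the rank function on finite matrices given by $\mathrm{rank}_\omega([(A_n)])=\lim_\omega \mathrm{rank}(A_n)/\dim_K(M_n)$. Let $\rho_\omega:R\to \mathrm{Mat}^{\mathcal M}_\omega$ be the ultraproduct representation, which sends $r$ to the class of the sequence of multiplications by $r$ on the modules $M_n$. Then there is a unital $K$-subalgebra $S$ with $\mathrm{Im}(\rho_\omega)\subseteq S\subseteq \mathrm{Mat}^{\mathcal M}_\omega$ and an isomorphism of $K$-algebras $S\cong M_K$ that preserves the ranks of all finite matrices. 2. There is a unital $K$-algebra homomorphism $\rho:R\to M_K$ such that $\mathrm{rank}_{M_K}(\rho(A))=\lim_{n\to\infty}\mathrm{rk}_{M_n}(A)$ for every finite matrix $A$ over $R$, where $\rho$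 is applied entrywise. (No assumption on the dimensions of the $M_n$ is made here.) -/

import Mathlib

open Filter Topology

noncomputable section

namespace RankSpectrum

/-! ### Normalized ranks of finite matrix algebras and the diagonal embeddings -/

/-- The `2 ^ s × 2 ^ s` matrices over `K`. -/
abbrev Dyadic (K : Type*) (s : ℕ) : Type _ := Matrix (Fin (2 ^ s)) (Fin (2 ^ s)) K

/-- The normalized rank of a `k × l` matrix over the algebra of `2 ^ s × 2 ^ s` matrices: the rank
of the associated `k 2 ^ s × l 2 ^ s` matrix over `K`, divided by `2 ^ s`. -/
def matRank {K : Type*} [Field K] {k l s : ℕ} (A : Matrix (Fin k) (Fin l) (Dyadic K s)) : ℝ :=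
  ((Matrix.comp (Fin k) (Fin l) (Fin (2 ^ s)) (Fin (2 ^ s)) K A).rank : ℝ) / 2 ^ s

/-- Positions inside a `2 ^ i` block, together with the number of the block. -/
def blockEquiv {i j : ℕ} (h : i ≤ j) : Fin (2 ^ i) × Fin (2 ^ (j - i)) ≃ Fin (2 ^ j) :=
  ((Equiv.prodComm _ _).trans finProdFinEquiv).trans
    (finCongr (by rw [← pow_add, Nat.sub_add_cancel h]))

/-- The diagonal embedding `A ↦ diag(A, A, …, A)`, with `2 ^ (j - i)` copies of `A`. -/
def diagEmb (K : Type*) [Field K] {i j : ℕ} (h : i ≤ j) : Dyadic K i →ₐ[K] Dyadic K j :=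
  (Matrix.reindexAlgEquiv K K (blockEquiv h)).toAlgHom.comp
    { (Matrix.blockDiagonalRingHom (Fin (2 ^ i)) (Fin (2 ^ (j - i))) K).comp
        (Pi.constRingHom (Fin (2 ^ (j - i))) (Dyadic K i)) with
      commutes' := by
        intro c
        ext ⟨a, b⟩ ⟨a', b'⟩
        simp [Matrix.blockDiagonal_apply, Matrix.algebraMap_matrix_apply, Prod.ext_iff]
        grind }

theorem blockEquiv_symm {i j : ℕ} (h : i ≤ j) (x : Fin (2 ^ j)) :
    (((blockEquiv h).symm x).1 : ℕ) = x % 2 ^ i ∧ (((blockEquiv h).symm x).2 : ℕ) = x / 2 ^ i := by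
  constructor <;> simp [blockEquiv]

theorem diagEmb_apply {K : Type*} [Field K] {i j : ℕ} (h : i ≤ j) (A : Dyadic K i)
    (x y : Fin (2 ^ j)) : diagEmb K h A x y =
      if (x : ℕ) / 2 ^ i = y / 2 ^ i then
        A ⟨x % 2 ^ i, Nat.mod_lt _ (by positivity)⟩ ⟨y % 2 ^ i, Nat.mod_lt _ (by positivity)⟩
      else 0 := by
  have hx := blockEquiv_symm h x
  have hy := blockEquiv_symm h y
  have e : diagEmb K h A x y =
      Matrix.blockDiagonal (fun _ : Fin (2 ^ (j - i)) => A)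
        ((blockEquiv h).symm x) ((blockEquiv h).symm y) := rfl
  rw [e, Matrix.blockDiagonal_apply]
  simp only [Fin.ext_iff, hx.2, hy.2]
  congr 2

instance (K : Type*) [Field K] :
    DirectedSystem (Dyadic K) (fun _ _ h => ⇑(diagEmb K h)) where
  map_self i A := by
    ext x y
    simp [diagEmb_apply, Nat.mod_eq_of_lt, Nat.div_eq_of_lt]
  map_map k j i hij hjk A := by
    ext x y
    obtain ⟨d, rfl⟩ := Nat.exists_eq_add_of_le hij
    have key : ∀ z : ℕ, z / 2 ^ i = 2 ^ d * (z / 2 ^ (i + d)) + z % 2 ^ (i + d) / 2 ^ i := by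
      intro z
      conv_lhs => rw [← Nat.div_add_mod z (2 ^ (i + d)), pow_add, mul_assoc,
        Nat.mul_add_div (by positivity)]
      rw [pow_add]
    have div : ∀ z : ℕ, z / 2 ^ (i + d) = z / 2 ^ i / 2 ^ d := by
      intro z
      rw [Nat.div_div_eq_div_mul, pow_add]
    have hiff : (x : ℕ) / 2 ^ i = (y : ℕ) / 2 ^ i ↔
        (x : ℕ) / 2 ^ (i + d) = (y : ℕ) / 2 ^ (i + d) ∧
        (x : ℕ) % 2 ^ (i + d) / 2 ^ i = (y : ℕ) % 2 ^ (i + d) / 2 ^ i := by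
      constructor
      · intro h
        have h1 : (x : ℕ) / 2 ^ (i + d) = (y : ℕ) / 2 ^ (i + d) := by rw [div, div, h]
        refine ⟨h1, ?_⟩
        rw [key x, key y, h1] at h
        exact Nat.add_left_cancel h
      · rintro ⟨h1, h2⟩
        rw [key x, key y, h1, h2]
    simp only [diagEmb_apply, Nat.mod_mod_of_dvd _ (pow_dvd_pow 2 hij), hiff, ite_and]

/-! ### The direct limit of the diagonal embeddings, with its rank -/

/-- The direct limit of `K → Mat_{2×2}(K) → Mat_{4×4}(K) → Mat_{8×8}(K) → ⋯`. -/
def DyadicLimit (K : Type*) [Field K] : Type _ :=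
  DirectLimit (Dyadic K) (fun _ _ h => diagEmb K h)

instance (K : Type*) [Field K] : Ring (DyadicLimit K) :=
  inferInstanceAs (Ring (DirectLimit (Dyadic K) (fun _ _ h => diagEmb K h)))

instance (K : Type*) [Field K] : Module K (DyadicLimit K) :=
  inferInstanceAs (Module K (DirectLimit (Dyadic K) (fun _ _ h => diagEmb K h)))

instance (K : Type*) [Field K] : IsScalarTower K (DyadicLimit K) (DyadicLimit K) :=
  inferInstanceAs (IsScalarTower K (DirectLimit (Dyadic K) (fun _ _ h => diagEmb K h))
    (DirectLimit (Dyadic K) (fun _ _ h => diagEmb K h)))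

instance (K : Type*) [Field K] : SMulCommClass K (DyadicLimit K) (DyadicLimit K) :=
  inferInstanceAs (SMulCommClass K (DirectLimit (Dyadic K) (fun _ _ h => diagEmb K h))
    (DirectLimit (Dyadic K) (fun _ _ h => diagEmb K h)))

instance (K : Type*) [Field K] : Algebra K (DyadicLimit K) :=
  Algebra.ofModule (fun r x y => smul_mul_assoc r x y) (fun r x y => mul_smul_comm r x y)

/-- The canonical map from the `s`-th matrix algebra to the direct limit. -/
def level (K : Type*) [Field K] (s : ℕ) : Dyadic K s →ₐ[K] DyadicLimit K :=
  AlgHom.ofLinearMap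
    { toFun := fun A => (⟦⟨s, A⟩⟧ : DirectLimit (Dyadic K) (fun _ _ h => diagEmb K h))
      map_add' := fun A B =>
        (DirectLimit.add_def (f := fun _ _ h => diagEmb K h) s A B).symm
      map_smul' := fun c A =>
        (DirectLimit.smul_def (f := fun _ _ h => diagEmb K h) s A c).symm }
    (DirectLimit.one_def (f := fun _ _ h => diagEmb K h) s).symm
    (fun A B => (DirectLimit.mul_def (f := fun _ _ h => diagEmb K h) s A B).symm)

theorem level_diagEmb {K : Type*} [Field K] {i j : ℕ} (h : i ≤ j) (A : Dyadic K i) :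
    level K j (diagEmb K h A) = level K i A :=
  DirectLimit.mk_apply (f := fun _ _ h => diagEmb K h) i j A h

theorem diagEmb_injective {K : Type*} [Field K] {i j : ℕ} (h : i ≤ j) :
    Function.Injective (diagEmb K h) :=
  (diagEmb K h).toRingHom.injective

theorem level_injective {K : Type*} [Field K] (s : ℕ) : Function.Injective (level K s) :=
  DirectLimit.mk_injective (fun _ _ h => diagEmb K h) (fun _ _ h => diagEmb_injective h) s

theorem exists_level {K : Type*} [Field K] {k l : ℕ} (A : Matrix (Fin k) (Fin l) (DyadicLimit K)) :
    ∃ (s : ℕ) (B : Matrix (Fin k) (Fin l) (Dyadic K s)), B.map (level K s) = A := by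
  have h : ∀ i j, ∃ (s : ℕ) (b : Dyadic K s), level K s b = A i j := by
    intro i j
    obtain ⟨s, b, hb⟩ := DirectLimit.exists_eq_mk (f := fun _ _ h => diagEmb K h) (A i j)
    exact ⟨s, b, hb.symm⟩
  choose s b hb using h
  let t : ℕ := Finset.univ.sup fun p : Fin k × Fin l => s p.1 p.2
  have ht : ∀ i j, s i j ≤ t := fun i j =>
    Finset.le_sup (f := fun p : Fin k × Fin l => s p.1 p.2) (Finset.mem_univ (i, j))
  refine ⟨t, Matrix.of fun i j => diagEmb K (ht i j) (b i j), ?_⟩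
  ext i j
  simp [level_diagEmb, hb]

/-- The rank function on the direct limit: a matrix over the direct limit comes from some
finite level, and its rank is the normalized rank there (see `limRank_map`). -/
def limRank {K : Type*} [Field K] {k l : ℕ} (A : Matrix (Fin k) (Fin l) (DyadicLimit K)) : ℝ :=
  matRank (exists_level A).choose_spec.choose

theorem finrank_range_compLeft {K V W ι : Type*} [Field K] [AddCommGroup V] [Module K V]
    [AddCommGroup W] [Module K W] [Fintype ι] (f : V →ₗ[K] W) [FiniteDimensional K W] :
    Module.finrank K (LinearMap.range (f.compLeft ι)) =
      Fintype.card ι * Module.finrank K (LinearMap.range f) := by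
  have h1 : LinearMap.range (f.compLeft ι) =
      LinearMap.range ((LinearMap.range f).subtype.compLeft ι) := by
    rw [LinearMap.range_compLeft, LinearMap.range_compLeft, Submodule.range_subtype]
  rw [h1, LinearMap.finrank_range_of_inj, Module.finrank_pi_fintype]
  · simp
  · intro x y hxy
    ext i
    exact congrFun hxy i

theorem rank_blockDiagonal_const {K m n o : Type*} [Field K] [Fintype m] [Fintype n] [Fintype o]
    [DecidableEq o] (A : Matrix m n K) :
    (Matrix.blockDiagonal fun _ : o => A).rank = Fintype.card o * A.rank := by
  let em : (m × o → K) ≃ₗ[K] (o → m → K) :=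
    (LinearEquiv.funCongrLeft K K (Equiv.prodComm o m)).trans (LinearEquiv.curry K K o m)
  let en : (n × o → K) ≃ₗ[K] (o → n → K) :=
    (LinearEquiv.funCongrLeft K K (Equiv.prodComm o n)).trans (LinearEquiv.curry K K o n)
  have h : em.toLinearMap ∘ₗ (Matrix.blockDiagonal fun _ : o => A).mulVecLin =
      (A.mulVecLin.compLeft o) ∘ₗ en.toLinearMap := by
    refine LinearMap.ext fun v => ?_
    funext b a
    simp [em, en, Matrix.mulVec, dotProduct, Fintype.sum_prod_type, Matrix.blockDiagonal_apply,
      LinearEquiv.funCongrLeft, LinearMap.funLeft]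
  rw [Matrix.rank, Matrix.rank, ← finrank_range_compLeft,
    ← LinearEquiv.finrank_map_eq em, ← LinearMap.range_comp, h, LinearMap.range_comp,
    LinearEquiv.range, Submodule.map_top]

theorem matRank_map_diagEmb {K : Type*} [Field K] {k l i j : ℕ} (h : i ≤ j)
    (A : Matrix (Fin k) (Fin l) (Dyadic K i)) : matRank (A.map (diagEmb K h)) = matRank A := by
  have e : Matrix.comp (Fin k) (Fin l) (Fin (2 ^ j)) (Fin (2 ^ j)) K (A.map (diagEmb K h)) =
      (Matrix.blockDiagonal fun _ : Fin (2 ^ (j - i)) =>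
        Matrix.comp (Fin k) (Fin l) (Fin (2 ^ i)) (Fin (2 ^ i)) K A).submatrix
        (((Equiv.refl (Fin k)).prodCongr (blockEquiv h).symm).trans
          (Equiv.prodAssoc _ _ _).symm)
        (((Equiv.refl (Fin l)).prodCongr (blockEquiv h).symm).trans
          (Equiv.prodAssoc _ _ _).symm) := by
    ext ⟨a, x⟩ ⟨b, y⟩
    rfl
  rw [matRank, matRank, e, Matrix.rank_submatrix, rank_blockDiagonal_const]
  obtain ⟨d, rfl⟩ := Nat.exists_eq_add_of_le h
  simp only [Fintype.card_fin, Nat.add_sub_cancel_left, pow_add]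
  push_cast
  field_simp

theorem limRank_map {K : Type*} [Field K] {k l s : ℕ} (B : Matrix (Fin k) (Fin l) (Dyadic K s)) :
    limRank (B.map (level K s)) = matRank B := by
  have h := (exists_level (B.map (level K s))).choose_spec.choose_spec
  unfold limRank
  generalize (exists_level (B.map (level K s))).choose_spec.choose = C at h ⊢
  generalize (exists_level (B.map (level K s))).choose = t at C h ⊢
  rw [← matRank_map_diagEmb (le_max_left t s) C, ← matRank_map_diagEmb (le_max_right t s) B]
  congr 1
  ext1 i j
  have hij := congrFun (congrFun h i) j
  simp only [Matrix.map_apply] at hij ⊢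
  apply level_injective
  rw [level_diagEmb, level_diagEmb, hij]

/-! ### The rank metric -/

theorem rank_add_le {K m n : Type*} [Field K] [Fintype m] [Fintype n] (A B : Matrix m n K) :
    (A + B).rank ≤ A.rank + B.rank := by
  rw [Matrix.rank, Matrix.rank, Matrix.rank, Matrix.mulVecLin_add]
  exact (Submodule.finrank_mono (LinearMap.range_add_le _ _)).trans
    (Submodule.finrank_add_le_finrank_add_finrank _ _)

theorem rank_neg {K m n : Type*} [Field K] [Fintype m] [Fintype n] (A : Matrix m n K) :
    (-A).rank = A.rank := by
  rw [Matrix.rank, Matrix.rank,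
    show (-A).mulVecLin = -A.mulVecLin from LinearMap.ext fun v => Matrix.neg_mulVec v A,
    LinearMap.range_neg]

theorem exists_level₂ {K : Type*} [Field K] {k l k' l' : ℕ}
    (A : Matrix (Fin k) (Fin l) (DyadicLimit K)) (A' : Matrix (Fin k') (Fin l') (DyadicLimit K)) :
    ∃ (s : ℕ) (B : Matrix (Fin k) (Fin l) (Dyadic K s))
      (B' : Matrix (Fin k') (Fin l') (Dyadic K s)),
      B.map (level K s) = A ∧ B'.map (level K s) = A' := by
  obtain ⟨s, B, rfl⟩ := exists_level A
  obtain ⟨t, C, rfl⟩ := exists_level A'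
  refine ⟨max s t, B.map (diagEmb K (le_max_left s t)), C.map (diagEmb K (le_max_right s t)), ?_, ?_⟩
    <;> (ext i j; simp [level_diagEmb])

theorem limRank_zero {K : Type*} [Field K] {k l : ℕ} :
    limRank (0 : Matrix (Fin k) (Fin l) (DyadicLimit K)) = 0 := by
  have : (0 : Matrix (Fin k) (Fin l) (DyadicLimit K)) =
      (0 : Matrix (Fin k) (Fin l) (Dyadic K 0)).map (level K 0) := by
    ext; simp
  rw [this, limRank_map, matRank]
  have : Matrix.comp (Fin k) (Fin l) (Fin (2 ^ 0)) (Fin (2 ^ 0)) K 0 = 0 := rfl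
  rw [this, Matrix.rank_zero]
  simp

theorem limRank_nonneg {K : Type*} [Field K] {k l : ℕ}
    (A : Matrix (Fin k) (Fin l) (DyadicLimit K)) : 0 ≤ limRank A := by
  unfold limRank matRank
  positivity

theorem limRank_add_le {K : Type*} [Field K] {k l : ℕ}
    (A B : Matrix (Fin k) (Fin l) (DyadicLimit K)) : limRank (A + B) ≤ limRank A + limRank B := by
  obtain ⟨s, A, B, rfl, rfl⟩ := exists_level₂ A B
  have : A.map (level K s) + B.map (level K s) = (A + B).map (level K s) := by
    ext; simp
  rw [this, limRank_map, limRank_map, limRank_map, matRank, matRank, matRank, ← add_div]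
  gcongr
  exact_mod_cast rank_add_le _ _

theorem limRank_neg {K : Type*} [Field K] {k l : ℕ}
    (A : Matrix (Fin k) (Fin l) (DyadicLimit K)) : limRank (-A) = limRank A := by
  obtain ⟨s, A, rfl⟩ := exists_level A
  have : -A.map (level K s) = (-A).map (level K s) := by
    ext; simp
  rw [this, limRank_map, limRank_map, matRank, matRank]
  congr 2
  exact rank_neg _

theorem limRank_mul_le {K : Type*} [Field K] {k l m : ℕ}
    (A : Matrix (Fin k) (Fin l) (DyadicLimit K)) (B : Matrix (Fin l) (Fin m) (DyadicLimit K)) :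
    limRank (A * B) ≤ min (limRank A) (limRank B) := by
  obtain ⟨s, A, B, rfl, rfl⟩ := exists_level₂ A B
  have e : A.map (level K s) * B.map (level K s) = (A * B).map (level K s) := by
    ext; simp [Matrix.mul_apply]
  have e' : Matrix.comp (Fin k) (Fin m) (Fin (2 ^ s)) (Fin (2 ^ s)) K (A * B) =
      Matrix.comp (Fin k) (Fin l) (Fin (2 ^ s)) (Fin (2 ^ s)) K A *
        Matrix.comp (Fin l) (Fin m) (Fin (2 ^ s)) (Fin (2 ^ s)) K B := by
    ext ⟨a, x⟩ ⟨b, y⟩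
    simp [Matrix.mul_apply, Fintype.sum_prod_type, Matrix.sum_apply]
  rw [e, limRank_map, limRank_map, limRank_map, matRank, matRank, matRank, e', le_min_iff]
  constructor <;> gcongr
  · exact Matrix.rank_mul_le_left _ _
  · exact Matrix.rank_mul_le_right _ _

theorem eq_zero_of_limRank {K : Type*} [Field K] {k l : ℕ}
    {A : Matrix (Fin k) (Fin l) (DyadicLimit K)} (h : limRank A = 0) : A = 0 := by
  obtain ⟨s, A, rfl⟩ := exists_level A
  rw [limRank_map, matRank, div_eq_zero_iff, or_iff_left (by positivity), Nat.cast_eq_zero,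
    Matrix.rank, Submodule.finrank_eq_zero, LinearMap.range_eq_bot] at h
  have h0 : Matrix.comp (Fin k) (Fin l) (Fin (2 ^ s)) (Fin (2 ^ s)) K A = 0 := by
    apply Matrix.ext_of_mulVec_single
    intro i
    rw [Matrix.zero_mulVec]
    exact LinearMap.congr_fun h (Pi.single i 1)
  have h1 : A = 0 := (Matrix.comp (Fin k) (Fin l) (Fin (2 ^ s)) (Fin (2 ^ s)) K).injective h0
  ext i j
  simp [h1]

/-- An element of the direct limit as a `1 × 1` matrix. -/
abbrev single {K : Type*} [Field K] (a : DyadicLimit K) : Matrix (Fin 1) (Fin 1) (DyadicLimit K) :=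
  Matrix.of fun _ _ => a

/-- The rank metric `d(a, b) = rank(a - b)`. -/
instance (K : Type*) [Field K] : MetricSpace (DyadicLimit K) where
  dist a b := limRank (single (a - b))
  dist_self a := by
    have : single (a - a) = 0 := by ext; simp
    rw [this, limRank_zero]
  dist_comm a b := by
    have : single (a - b) = -single (b - a) := by ext; simp
    rw [this, limRank_neg]
  dist_triangle a b c := by
    have : single (a - c) = single (a - b) + single (b - c) := by ext; simp
    rw [this]
    exact limRank_add_le _ _
  eq_of_dist_eq_zero {a b} h :=
    sub_eq_zero.1 (congrFun (congrFun (eq_zero_of_limRank h) 0) 0)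

theorem dist_def {K : Type*} [Field K] (a b : DyadicLimit K) :
    dist a b = limRank (single (a - b)) := rfl

theorem dist_sub_sub_le {K : Type*} [Field K] (a b a' b' : DyadicLimit K) :
    dist (a - b) (a' - b') ≤ dist a a' + dist b b' := by
  have : single (a - b - (a' - b')) = single (a - a') + -single (b - b') := by
    ext; simp; abel
  rw [dist_def, this]
  exact (limRank_add_le _ _).trans (by rw [limRank_neg]; rfl)

theorem dist_mul_mul_le {K : Type*} [Field K] (a b a' b' : DyadicLimit K) :
    dist (a * b) (a' * b') ≤ dist a a' + dist b b' := by
  have : single (a * b - a' * b') =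
      single (a - a') * single b + single a' * single (b - b') := by
    ext; simp [Matrix.mul_apply]; noncomm_ring
  rw [dist_def, this]
  refine (limRank_add_le _ _).trans (add_le_add ?_ ?_)
  · exact (limRank_mul_le _ _).trans (min_le_left _ _)
  · exact (limRank_mul_le _ _).trans (min_le_right _ _)

instance (K : Type*) [Field K] : IsUniformAddGroup (DyadicLimit K) where
  uniformContinuous_sub := by
    rw [Metric.uniformContinuous_iff]
    intro ε hε
    refine ⟨ε / 2, half_pos hε, fun {p q} h => ?_⟩
    rw [Prod.dist_eq, max_lt_iff] at h
    exact (dist_sub_sub_le _ _ _ _).trans_lt (by linarith [h.1, h.2])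

instance (K : Type*) [Field K] : IsTopologicalRing (DyadicLimit K) where
  continuous_mul := by
    refine UniformContinuous.continuous ?_
    rw [Metric.uniformContinuous_iff]
    intro ε hε
    refine ⟨ε / 2, half_pos hε, fun {p q} h => ?_⟩
    rw [Prod.dist_eq, max_lt_iff] at h
    exact (dist_mul_mul_le _ _ _ _).trans_lt (by linarith [h.1, h.2])

instance (K : Type*) [Field K] : UniformContinuousConstSMul K (DyadicLimit K) where
  uniformContinuous_const_smul c := by
    rw [Metric.uniformContinuous_iff]
    intro ε hε
    refine ⟨ε, hε, fun {a b} h => ?_⟩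
    rw [Algebra.smul_def, Algebra.smul_def]
    exact (dist_mul_mul_le _ _ _ _).trans_lt (by simpa using h)

/-! ### Von Neumann's continuous algebra -/

/-- Von Neumann's continuous algebra `M_K`: the completion of the direct limit in the rank
metric. -/
abbrev VonNeumann (K : Type*) [Field K] : Type _ := UniformSpace.Completion (DyadicLimit K)

theorem isDenseInducing_map_coe (K : Type*) [Field K] (k l : ℕ) :
    IsDenseInducing fun A : Matrix (Fin k) (Fin l) (DyadicLimit K) =>
      (A.map (fun a => (a : VonNeumann K)) : Matrix (Fin k) (Fin l) (VonNeumann K)) where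
  toIsInducing := Topology.IsInducing.piMap fun _ => Topology.IsInducing.piMap fun _ =>
    UniformSpace.Completion.isDenseInducing_coe.toIsInducing
  dense := DenseRange.piMap fun _ => DenseRange.piMap fun _ =>
    UniformSpace.Completion.isDenseInducing_coe.dense

/-- The rank of a finite matrix over `M_K`: the extension by continuity of the rank of finite
matrices over the direct limit. -/
def vnRank {K : Type*} [Field K] {k l : ℕ} (A : Matrix (Fin k) (Fin l) (VonNeumann K)) : ℝ :=
  (isDenseInducing_map_coe K k l).extend limRank A

theorem limRank_le_sum {K : Type*} [Field K] {k l : ℕ}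
    (A : Matrix (Fin k) (Fin l) (DyadicLimit K)) :
    limRank A ≤ ∑ i, ∑ j, limRank (single (A i j)) := by
  have h1 : ∀ (t : Finset (Fin k × Fin l)) (f : Fin k × Fin l → Matrix (Fin k) (Fin l)
      (DyadicLimit K)), limRank (∑ p ∈ t, f p) ≤ ∑ p ∈ t, limRank (f p) := fun t f =>
    Finset.le_sum_of_subadditive _ limRank_zero.le limRank_add_le t f
  rw [← Fintype.sum_prod_type']
  conv_lhs => rw [A.matrix_eq_sum_single, ← Fintype.sum_prod_type']
  refine (h1 _ _).trans (Finset.sum_le_sum fun p _ => ?_)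
  have h2 : Matrix.single p.1 p.2 (A p.1 p.2) =
      (Matrix.of fun i (_ : Fin 1) => if p.1 = i then (1 : DyadicLimit K) else 0) * single (A p.1 p.2) *
        (Matrix.of fun (_ : Fin 1) j => if p.2 = j then (1 : DyadicLimit K) else 0) := by
    ext i j
    simp only [Matrix.mul_apply, Matrix.single_apply, Matrix.of_apply, Fin.sum_univ_one, ite_and]
    split_ifs <;> simp
  rw [h2]
  exact ((limRank_mul_le _ _).trans (min_le_left _ _)).trans
    ((limRank_mul_le _ _).trans (min_le_right _ _))

theorem continuous_limRank {K : Type*} [Field K] {k l : ℕ} :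
    Continuous (limRank : Matrix (Fin k) (Fin l) (DyadicLimit K) → ℝ) := by
  rw [continuous_iff_continuousAt]
  intro A
  rw [ContinuousAt, tendsto_iff_dist_tendsto_zero]
  have hb : Tendsto (fun B : Matrix (Fin k) (Fin l) (DyadicLimit K) =>
      ∑ i, ∑ j, dist (B i j) (A i j)) (𝓝 A) (𝓝 0) := by
    have hc : Continuous fun B : Matrix (Fin k) (Fin l) (DyadicLimit K) =>
        ∑ i, ∑ j, dist (B i j) (A i j) := by fun_prop
    simpa using hc.tendsto A
  refine squeeze_zero (fun _ => dist_nonneg) (fun B => ?_) hb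
  have h1 := limRank_add_le (B - A) A
  have h2 := limRank_add_le (A - B) B
  have h3 := limRank_le_sum (B - A)
  have h4 : limRank (A - B) = limRank (B - A) := by rw [← neg_sub, limRank_neg]
  rw [sub_add_cancel] at h1 h2
  rw [Real.dist_eq, abs_le]
  simp only [dist_def]
  simp only [Matrix.sub_apply] at h3
  constructor <;> linarith

theorem vnRank_map_coe {K : Type*} [Field K] {k l : ℕ}
    (A : Matrix (Fin k) (Fin l) (DyadicLimit K)) :
    vnRank (A.map (fun a => (a : VonNeumann K))) = limRank A :=
  (isDenseInducing_map_coe K k l).extend_eq continuous_limRank A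

/-! ### Finitely generated modules, their ranks, and hyperfiniteness -/

/-- The linear map `V ^ l → V ^ k` given by a `k × l` matrix of endomorphisms of `V`. -/
def matAct {K V : Type*} [Field K] [AddCommGroup V] [Module K V] {k l : ℕ}
    (A : Matrix (Fin k) (Fin l) (Module.End K V)) : (Fin l → V) →ₗ[K] (Fin k → V) :=
  LinearMap.pi fun i => ∑ j, A i j ∘ₗ LinearMap.proj j

/-- The normalized rank of a `k × l` matrix of endomorphisms of `V`, that is, the rank of the
associated linear map `V ^ l → V ^ k` divided by `dim V`. -/
def endMatRank {K V : Type*} [Field K] [AddCommGroup V] [Module K V] {k l : ℕ}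
    (A : Matrix (Fin k) (Fin l) (Module.End K V)) : ℝ :=
  (Module.finrank K (LinearMap.range (matAct A)) : ℝ) / Module.finrank K V

/-- The rank function `rk_M` of an `R`-module `M`, on `k × l` matrices over `R`. -/
def moduleRank (K : Type*) {R : Type*} (M : Type*) [Field K] [Ring R] [Algebra K R]
    [AddCommGroup M] [Module K M] [Module R M] [IsScalarTower K R M] {k l : ℕ}
    (A : Matrix (Fin k) (Fin l) R) : ℝ :=
  endMatRank (A.map (Algebra.lsmul K K M))

/-- Convergence of a sequence of modules: the ranks of every matrix over `R` converge. -/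
def RankConvergent (K R : Type*) [Field K] [Ring R] [Algebra K R] (M : ℕ → Type*)
    [∀ n, AddCommGroup (M n)] [∀ n, Module K (M n)] [∀ n, Module R (M n)]
    [∀ n, IsScalarTower K R (M n)] : Prop :=
  ∀ (k l : ℕ) (A : Matrix (Fin k) (Fin l) R),
    ∃ r : ℝ, Tendsto (fun n => moduleRank K (M n) A) atTop (𝓝 r)

/-- A sequence of modules is hyperfinite if for every `ε > 0` there are finitely many finitely
generated modules `N₁, …, N_t` such that each `M n` has a submodule `P`, with
`dim P ≥ (1 - ε) dim (M n)`, that is isomorphic to a direct sum `⨁ N_i ^ α_i`. -/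
def Hyperfinite.{w} (K R : Type*) [Field K] [Ring R] [Algebra K R] (M : ℕ → Type w)
    [∀ n, AddCommGroup (M n)] [∀ n, Module K (M n)] [∀ n, Module R (M n)]
    [∀ n, IsScalarTower K R (M n)] : Prop :=
  ∀ ε : ℝ, 0 < ε → ∃ (t : ℕ) (N : Fin t → ModuleCat.{w} R), (∀ i, Module.Finite R (N i)) ∧
    ∀ n, ∃ (P : Submodule R (M n)) (α : Fin t → ℕ),
      (1 - ε) * (Module.finrank K (M n) : ℝ) ≤ (Module.finrank K P : ℝ) ∧
      Nonempty (P ≃ₗ[R] ∀ i, Fin (α i) → N i)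

/-! ### The continuous ultraproduct -/

/-- The normalized rank of an endomorphism. -/
def endRank {K V : Type*} [Field K] [AddCommGroup V] [Module K V] (a : Module.End K V) : ℝ :=
  (Module.finrank K (LinearMap.range a) : ℝ) / Module.finrank K V

theorem endRank_nonneg {K V : Type*} [Field K] [AddCommGroup V] [Module K V]
    (a : Module.End K V) : 0 ≤ endRank a := by
  unfold endRank
  positivity

theorem endRank_add_le {K V : Type*} [Field K] [AddCommGroup V] [Module K V] [Module.Finite K V]
    (a b : Module.End K V) : endRank (a + b) ≤ endRank a + endRank b := by
  rw [endRank, endRank, endRank, ← add_div]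
  gcongr
  exact_mod_cast (Submodule.finrank_mono (LinearMap.range_add_le a b)).trans
    (Submodule.finrank_add_le_finrank_add_finrank _ _)

theorem endRank_mul_le_left {K V : Type*} [Field K] [AddCommGroup V] [Module K V]
    [Module.Finite K V] (a b : Module.End K V) : endRank (a * b) ≤ endRank a := by
  rw [endRank, endRank]
  gcongr
  exact Submodule.finrank_mono (LinearMap.range_comp_le_range b a)

theorem endRank_mul_le_right {K V : Type*} [Field K] [AddCommGroup V] [Module K V]
    [Module.Finite K V] (a b : Module.End K V) : endRank (a * b) ≤ endRank b := by
  rw [endRank, endRank]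
  gcongr
  rw [Module.End.mul_eq_comp, LinearMap.range_comp]
  exact Submodule.finrank_map_le _ _

/-- The ideal of the sequences whose normalized ranks tend to zero along `ω`. -/
def rankIdeal (K : Type*) [Field K] (V : ℕ → Type*) [∀ n, AddCommGroup (V n)]
    [∀ n, Module K (V n)] [∀ n, Module.Finite K (V n)] (ω : Ultrafilter ℕ) :
    Ideal (∀ n, Module.End K (V n)) where
  carrier := {a | Tendsto (fun n => endRank (a n)) ω (𝓝 0)}
  zero_mem' := by
    have h : ∀ n, endRank (0 : Module.End K (V n)) = 0 := fun n => by
      rw [endRank, LinearMap.range_zero, finrank_bot, Nat.cast_zero, zero_div]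
    simp [h]
  add_mem' {a b} ha hb := by
    have h := Tendsto.add ha hb
    rw [add_zero] at h
    exact squeeze_zero (fun _ => endRank_nonneg _) (fun n => endRank_add_le (a n) (b n)) h
  smul_mem' c a ha :=
    squeeze_zero (fun _ => endRank_nonneg _) (fun n => endRank_mul_le_right (c n) (a n)) ha

instance (K : Type*) [Field K] (V : ℕ → Type*) [∀ n, AddCommGroup (V n)]
    [∀ n, Module K (V n)] [∀ n, Module.Finite K (V n)] (ω : Ultrafilter ℕ) :
    (rankIdeal K V ω).IsTwoSided where
  mul_mem_of_left {a} c ha :=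
    squeeze_zero (fun _ => endRank_nonneg _) (fun n => endRank_mul_le_left (a n) (c n)) ha

/-- The continuous ultraproduct of the algebras `End_K (V n)`, that is, of the matrix algebras of
size `dim V n`, along `ω`. -/
abbrev ContUltraproduct (K : Type*) [Field K] (V : ℕ → Type*) [∀ n, AddCommGroup (V n)]
    [∀ n, Module K (V n)] [∀ n, Module.Finite K (V n)] (ω : Ultrafilter ℕ) : Type _ :=
  (∀ n, Module.End K (V n)) ⧸ rankIdeal K V ω

/-- The rank of a matrix over the continuous ultraproduct: the ultralimit of the normalized ranks
of the terms of a representing sequence. -/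
def ultraRank {K : Type*} [Field K] {V : ℕ → Type*} [∀ n, AddCommGroup (V n)]
    [∀ n, Module K (V n)] [∀ n, Module.Finite K (V n)] {ω : Ultrafilter ℕ} {k l : ℕ}
    (A : Matrix (Fin k) (Fin l) (ContUltraproduct K V ω)) : ℝ :=
  limUnder (ω : Filter ℕ) fun n =>
    endMatRank (A.map fun x => Function.surjInv Ideal.Quotient.mk_surjective x n)

/-- The ultraproduct representation `r ↦ [(r acting on M n)_n]`. -/
def ultraRep (K R : Type*) [Field K] [Ring R] [Algebra K R] (M : ℕ → Type*)
    [∀ n, AddCommGroup (M n)] [∀ n, Module K (M n)] [∀ n, Module R (M n)]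
    [∀ n, IsScalarTower K R (M n)] [∀ n, Module.Finite K (M n)] (ω : Ultrafilter ℕ) :
    R →ₐ[K] ContUltraproduct K M ω :=
  (Ideal.Quotient.mkₐ K (rankIdeal K M ω)).comp
    (AlgHom.pi fun n => Algebra.lsmul K K (M n))

end RankSpectrum

end

/-!
Two families of endomorphisms, indexed by the same set but living on spaces `V` and `W` of possibly
different dimensions, are called near (`Near`) if linear maps `V → W` and `W → V` are inverse to
each other and intertwine the families, all up to a rank that is small compared with the dimensions.
Nearness passes to compositions and direct sums, ignores invariant subspaces of small codimension,
and between spaces of the same dimension it amounts to conjugacy up to small rank. An `R`-module is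
viewed as the family of the multiplications by the elements of `R`.

The argument rests on hyperfiniteness through `NearHyperfinite.eventually_near`: since the
proportions of the summands `N_i` in `M_n` converge along `ω`, for almost every `m` almost every
`M_n` is nearly a direct sum of copies of the single module `M_m`. Repeating a suitable `M_m` so
that it fills up a space of dimension `2 ^ s` gives a dyadic model `T : R → Mat_{2^s}(K)` of the
whole sequence, and a later, more precise model is, after a conjugation, close to the block diagonal
image of the earlier one (`IsModel.exists_refinement`). So there is a sequence of models, with
errors `2 ^ (-m)`, that is Cauchy in the direct limit (`NearHyperfinite.exists_models`). Choosing
for each `n` one of these models, whose precision tends to infinity slowly with `n`, yields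
coordinates on `M_n` in which every `r ∈ R` is approximated by block diagonal repetitions of dyadic
matrices that do not depend on `n` (`NearHyperfinite.exists_coordinates`).

In these coordinates the block diagonal repetition of dyadic matrices (`inflate`) defines a unital
homomorphism from the direct limit to the ultraproduct, which preserves ranks, because the
dimensions tend to infinity. The ultraproduct is complete in its rank metric
(`completeSpace_contUltraproduct`), so this isometry extends to the completion `M_K`. Its image is
closed, and therefore contains the image of `R`; it is the subalgebra sought. Ranks of matrices over
`M_K` agree with those over the ultraproduct, since both extend the rank over the direct limit
continuously.

For the second assertion, `M_n` is replaced by `n + 1` copies of itself. This leaves the rank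
functions unchanged and makes the dimensions tend to infinity, so that the first part applies to any
non-principal ultrafilter; convergence identifies the ultralimits of ranks with their limits.
-/

noncomputable section

namespace RankSpectrum

/-! ### Ranks of linear maps -/

section rank

variable {K V W X : Type*} [Field K] [AddCommGroup V] [Module K V] [AddCommGroup W] [Module K W]
  [AddCommGroup X] [Module K X]

/-- The rank of a linear map, as a natural number. -/
def rk (f : V →ₗ[K] W) : ℕ := Module.finrank K (LinearMap.range f)

theorem rk_zero : rk (0 : V →ₗ[K] W) = 0 := by
  rw [rk, LinearMap.range_zero, finrank_bot]

theorem rk_neg (f : V →ₗ[K] W) : rk (-f) = rk f := by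
  rw [rk, LinearMap.range_neg, rk]

theorem rk_sub_comm (f g : V →ₗ[K] W) : rk (f - g) = rk (g - f) := by
  rw [← rk_neg, neg_sub]

theorem rk_le_codomain [Module.Finite K W] (f : V →ₗ[K] W) : rk f ≤ Module.finrank K W :=
  Submodule.finrank_le _

theorem rk_le_domain [Module.Finite K V] (f : V →ₗ[K] W) : rk f ≤ Module.finrank K V :=
  LinearMap.finrank_range_le f

theorem rk_add_le [Module.Finite K W] (f g : V →ₗ[K] W) : rk (f + g) ≤ rk f + rk g :=
  (Submodule.finrank_mono (LinearMap.range_add_le f g)).trans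
    (Submodule.finrank_add_le_finrank_add_finrank _ _)

theorem rk_sub_le [Module.Finite K W] (f g : V →ₗ[K] W) : rk (f - g) ≤ rk f + rk g := by
  rw [sub_eq_add_neg, ← rk_neg g]
  exact rk_add_le _ _

theorem rk_sub_le_add [Module.Finite K W] (f g h : V →ₗ[K] W) :
    rk (f - h) ≤ rk (f - g) + rk (g - h) := by
  rw [← sub_add_sub_cancel f g h]
  exact rk_add_le _ _

theorem rk_comp_le_left [Module.Finite K X] (g : W →ₗ[K] X) (f : V →ₗ[K] W) :
    rk (g ∘ₗ f) ≤ rk g :=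
  Submodule.finrank_mono (LinearMap.range_comp_le_range f g)

theorem rk_comp_le_right [Module.Finite K W] (g : W →ₗ[K] X) (f : V →ₗ[K] W) :
    rk (g ∘ₗ f) ≤ rk f := by
  rw [rk, LinearMap.range_comp]
  exact Submodule.finrank_map_le _ _

theorem rk_comp_of_injective {g : W →ₗ[K] X} (hg : Function.Injective g) (f : V →ₗ[K] W) :
    rk (g ∘ₗ f) = rk f := by
  rw [rk, LinearMap.range_comp]
  exact (Submodule.equivMapOfInjective g hg _).finrank_eq.symm

theorem rk_comp_of_surjective (g : W →ₗ[K] X) {f : V →ₗ[K] W} (hf : Function.Surjective f) :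
    rk (g ∘ₗ f) = rk g := by
  rw [rk, LinearMap.range_comp_of_range_eq_top _ (LinearMap.range_eq_top.2 hf), rk]

theorem rk_conj (e : V ≃ₗ[K] W) (f : Module.End K V) : rk (e.conj f) = rk f := by
  rw [LinearEquiv.conj_apply, rk_comp_of_surjective _ e.symm.surjective,
    rk_comp_of_injective e.injective]

theorem rk_sum_le [Module.Finite K W] {ι : Type*} (s : Finset ι) (f : ι → V →ₗ[K] W) :
    rk (∑ i ∈ s, f i) ≤ ∑ i ∈ s, rk (f i) :=
  Finset.le_sum_of_subadditive _ rk_zero.le rk_add_le s f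

theorem rk_piMap_le {ι : Type*} [Fintype ι] {V W : ι → Type*} [∀ i, AddCommGroup (V i)]
    [∀ i, Module K (V i)] [∀ i, AddCommGroup (W i)] [∀ i, Module K (W i)]
    [∀ i, Module.Finite K (W i)] (f : ∀ i, V i →ₗ[K] W i) :
    rk (LinearMap.piMap f) ≤ ∑ i, rk (f i) := by
  classical
  have h : LinearMap.piMap f =
      ∑ i, LinearMap.single K W i ∘ₗ f i ∘ₗ LinearMap.proj i := by
    ext v i
    simp
  rw [h]
  refine (rk_sum_le _ _).trans (Finset.sum_le_sum fun i _ => ?_)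
  exact (rk_comp_le_right _ _).trans (rk_comp_le_left _ _)

theorem finrank_ker_le_of_rk_sub_one_le [Module.Finite K V] [Module.Finite K W] {c : ℕ}
    {f : V →ₗ[K] W} {g : W →ₗ[K] V} (h : rk (g ∘ₗ f - 1) ≤ c) :
    Module.finrank K (LinearMap.ker f) ≤ c := by
  refine le_trans (Submodule.finrank_mono fun v hv => ?_) h
  exact ⟨-v, by simp [LinearMap.mem_ker.1 hv]⟩

/-- Between spaces of equal dimension every linear map agrees with an isomorphism up to rank at
most the dimension of its kernel. -/
theorem exists_equiv_rk_sub_le [Module.Finite K V] [Module.Finite K W]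
    (h : Module.finrank K V = Module.finrank K W) (f : V →ₗ[K] W) :
    ∃ e : V ≃ₗ[K] W, rk (e.toLinearMap - f) ≤ Module.finrank K (LinearMap.ker f) := by
  obtain ⟨C, hC⟩ := Submodule.exists_isCompl (LinearMap.ker f)
  obtain ⟨D, hD⟩ := Submodule.exists_isCompl (LinearMap.range f)
  have hrank := LinearMap.finrank_range_add_finrank_ker f
  have hD' := Submodule.finrank_add_eq_of_isCompl hD
  have hk : Module.finrank K (LinearMap.ker f) = Module.finrank K D := by omega
  let eC : C ≃ₗ[K] LinearMap.range f := f.kerComplementEquivRange hC.symm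
  let eD : LinearMap.ker f ≃ₗ[K] D := LinearEquiv.ofFinrankEq _ _ hk
  let a := Submodule.prodEquivOfIsCompl _ _ hC
  let b := Submodule.prodEquivOfIsCompl _ _ hD
  let e : V ≃ₗ[K] W := a.symm.trans
    (((eD.prodCongr eC).trans (LinearEquiv.prodComm K _ _)).trans b)
  have he : e.toLinearMap - f =
      (D.subtype ∘ₗ eD.toLinearMap ∘ₗ LinearMap.fst K _ _) ∘ₗ a.symm.toLinearMap := by
    rw [← LinearMap.cancel_right (g := a.toLinearMap) a.surjective]
    ext x
    · simp [e, a, b]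
    · simp [e, a, b, eC]
  refine ⟨e, ?_⟩
  rw [he]
  exact (rk_comp_le_left _ _).trans ((rk_comp_le_right _ _).trans
    ((rk_comp_le_right _ _).trans ((rk_le_codomain _))))

end rank

/-! ### Systems of endomorphisms that are close in rank -/

section near

variable {K ι V W X : Type*} [Field K] [AddCommGroup V] [Module K V] [AddCommGroup W] [Module K W]
  [AddCommGroup X] [Module K X]

/-- Two families of endomorphisms, of spaces `V` and `W` whose dimensions may differ, are near up
to `c` if there are linear maps `V → W` and `W → V` that are mutually inverse up to rank `c` and
intertwine the two families up to rank `c`. -/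
def Near (φ : ι → Module.End K V) (ψ : ι → Module.End K W) (c : ℝ) : Prop :=
  ∃ (f : V →ₗ[K] W) (g : W →ₗ[K] V), (rk (f ∘ₗ g - 1) : ℝ) ≤ c ∧ (rk (g ∘ₗ f - 1) : ℝ) ≤ c ∧
    ∀ i, (rk (f ∘ₗ φ i - ψ i ∘ₗ f) : ℝ) ≤ c

/-- The direct sum of a finite collection of families of endomorphisms. -/
def directSum {J : Type*} {V : J → Type*} [∀ j, AddCommGroup (V j)] [∀ j, Module K (V j)]
    (φ : ∀ j, ι → Module.End K (V j)) (i : ι) : Module.End K (∀ j, V j) :=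
  LinearMap.piMap fun j => φ j i

/-- The direct sum of `q` copies of a family of endomorphisms. -/
def copies (q : ℕ) (φ : ι → Module.End K V) : ι → Module.End K (Fin q → V) :=
  directSum fun _ => φ

@[simp] theorem directSum_apply {J : Type*} {V : J → Type*} [∀ j, AddCommGroup (V j)]
    [∀ j, Module K (V j)] (φ : ∀ j, ι → Module.End K (V j)) (i : ι) (v : ∀ j, V j) (j : J) :
    directSum φ i v j = φ j i (v j) := rfl

@[simp] theorem copies_apply (q : ℕ) (φ : ι → Module.End K V) (i : ι) (v : Fin q → V)
    (j : Fin q) : copies q φ i v j = φ i (v j) := rfl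

variable {φ : ι → Module.End K V} {ψ : ι → Module.End K W} {χ : ι → Module.End K X} {c c' : ℝ}

theorem Near.mono (h : Near φ ψ c) (hc : c ≤ c') : Near φ ψ c' := by
  obtain ⟨f, g, h1, h2, h3⟩ := h
  exact ⟨f, g, h1.trans hc, h2.trans hc, fun i => (h3 i).trans hc⟩

theorem Near.of_equiv (e : V ≃ₗ[K] W) (h : ∀ i v, e (φ i v) = ψ i (e v)) : Near φ ψ 0 := by
  refine ⟨e, e.symm, ?_, ?_, fun i => ?_⟩
  · rw [show e.toLinearMap ∘ₗ e.symm.toLinearMap - 1 = 0 by ext; simp, rk_zero, Nat.cast_zero]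
  · rw [show e.symm.toLinearMap ∘ₗ e.toLinearMap - 1 = 0 by ext; simp, rk_zero, Nat.cast_zero]
  · rw [show e.toLinearMap ∘ₗ φ i - ψ i ∘ₗ e.toLinearMap = 0 by ext; simp [h], rk_zero,
      Nat.cast_zero]

theorem Near.trans [Module.Finite K V] [Module.Finite K W] [Module.Finite K X]
    (h : Near φ ψ c) (h' : Near ψ χ c') : Near φ χ (c + c') := by
  obtain ⟨f, g, h1, h2, h3⟩ := h
  obtain ⟨f', g', h1', h2', h3'⟩ := h'
  refine ⟨f' ∘ₗ f, g ∘ₗ g', ?_, ?_, fun i => ?_⟩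
  · have e : (f' ∘ₗ f) ∘ₗ g ∘ₗ g' - 1 = f' ∘ₗ (f ∘ₗ g - 1) ∘ₗ g' + (f' ∘ₗ g' - 1) := by
      ext v; simp
    have : rk ((f' ∘ₗ f) ∘ₗ g ∘ₗ g' - 1) ≤ rk (f ∘ₗ g - 1) + rk (f' ∘ₗ g' - 1) := by
      rw [e]
      refine (rk_add_le _ _).trans (Nat.add_le_add_right ?_ _)
      exact (rk_comp_le_right _ _).trans (rk_comp_le_left _ _)
    have : (rk ((f' ∘ₗ f) ∘ₗ g ∘ₗ g' - 1) : ℝ) ≤ rk (f ∘ₗ g - 1) + rk (f' ∘ₗ g' - 1) :=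
      mod_cast this
    linarith
  · have e : (g ∘ₗ g') ∘ₗ f' ∘ₗ f - 1 = g ∘ₗ (g' ∘ₗ f' - 1) ∘ₗ f + (g ∘ₗ f - 1) := by
      ext v; simp
    have : rk ((g ∘ₗ g') ∘ₗ f' ∘ₗ f - 1) ≤ rk (g' ∘ₗ f' - 1) + rk (g ∘ₗ f - 1) := by
      rw [e]
      refine (rk_add_le _ _).trans (Nat.add_le_add_right ?_ _)
      exact (rk_comp_le_right _ _).trans (rk_comp_le_left _ _)
    have : (rk ((g ∘ₗ g') ∘ₗ f' ∘ₗ f - 1) : ℝ) ≤ rk (g' ∘ₗ f' - 1) + rk (g ∘ₗ f - 1) :=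
      mod_cast this
    linarith
  · have e : (f' ∘ₗ f) ∘ₗ φ i - χ i ∘ₗ f' ∘ₗ f =
        f' ∘ₗ (f ∘ₗ φ i - ψ i ∘ₗ f) + (f' ∘ₗ ψ i - χ i ∘ₗ f') ∘ₗ f := by
      ext v; simp
    have : rk ((f' ∘ₗ f) ∘ₗ φ i - χ i ∘ₗ f' ∘ₗ f) ≤
        rk (f ∘ₗ φ i - ψ i ∘ₗ f) + rk (f' ∘ₗ ψ i - χ i ∘ₗ f') := by
      rw [e]
      exact (rk_add_le _ _).trans
        (Nat.add_le_add (rk_comp_le_right _ _) (rk_comp_le_left _ _))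
    have : (rk ((f' ∘ₗ f) ∘ₗ φ i - χ i ∘ₗ f' ∘ₗ f) : ℝ) ≤
        rk (f ∘ₗ φ i - ψ i ∘ₗ f) + rk (f' ∘ₗ ψ i - χ i ∘ₗ f') := mod_cast this
    linarith [h3 i, h3' i]

theorem Near.symm [Module.Finite K V] [Module.Finite K W] (h : Near φ ψ c) :
    Near ψ φ (3 * c) := by
  obtain ⟨f, g, h1, h2, h3⟩ := h
  have hc : 0 ≤ c := (Nat.cast_nonneg _).trans h1
  refine ⟨g, f, by linarith, by linarith, fun i => ?_⟩
  have e : g ∘ₗ ψ i - φ i ∘ₗ g = (g ∘ₗ f - 1) ∘ₗ (φ i ∘ₗ g) -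
      (g ∘ₗ (f ∘ₗ φ i - ψ i ∘ₗ f) ∘ₗ g + (g ∘ₗ ψ i) ∘ₗ (f ∘ₗ g - 1)) := by
    ext v; simp
  have : rk (g ∘ₗ ψ i - φ i ∘ₗ g) ≤ rk (g ∘ₗ f - 1) +
      (rk (f ∘ₗ φ i - ψ i ∘ₗ f) + rk (f ∘ₗ g - 1)) := by
    rw [e]
    refine (rk_sub_le _ _).trans (Nat.add_le_add (rk_comp_le_left _ _)
      ((rk_add_le _ _).trans (Nat.add_le_add ?_ (rk_comp_le_right _ _))))
    exact (rk_comp_le_right _ _).trans (rk_comp_le_left _ _)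
  have : (rk (g ∘ₗ ψ i - φ i ∘ₗ g) : ℝ) ≤ rk (g ∘ₗ f - 1) +
      (rk (f ∘ₗ φ i - ψ i ∘ₗ f) + rk (f ∘ₗ g - 1)) := mod_cast this
  linarith [h3 i]

theorem Near.directSum {J : Type*} [Fintype J] {V W : J → Type*} [∀ j, AddCommGroup (V j)]
    [∀ j, Module K (V j)] [∀ j, AddCommGroup (W j)] [∀ j, Module K (W j)]
    [∀ j, Module.Finite K (V j)] [∀ j, Module.Finite K (W j)]
    {φ : ∀ j, ι → Module.End K (V j)} {ψ : ∀ j, ι → Module.End K (W j)} {c : J → ℝ}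
    (h : ∀ j, Near (φ j) (ψ j) (c j)) : Near (directSum φ) (directSum ψ) (∑ j, c j) := by
  choose f g h1 h2 h3 using h
  refine ⟨LinearMap.piMap f, LinearMap.piMap g, ?_, ?_, fun i => ?_⟩
  · have e : LinearMap.piMap f ∘ₗ LinearMap.piMap g - 1 =
      LinearMap.piMap fun j => f j ∘ₗ g j - 1 := by ext v; simp
    rw [e]
    refine (Nat.cast_le.2 (rk_piMap_le _)).trans ?_
    push_cast
    exact Finset.sum_le_sum fun j _ => h1 j
  · have e : LinearMap.piMap g ∘ₗ LinearMap.piMap f - 1 =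
      LinearMap.piMap fun j => g j ∘ₗ f j - 1 := by ext v; simp
    rw [e]
    refine (Nat.cast_le.2 (rk_piMap_le _)).trans ?_
    push_cast
    exact Finset.sum_le_sum fun j _ => h2 j
  · have e : LinearMap.piMap f ∘ₗ RankSpectrum.directSum φ i -
        RankSpectrum.directSum ψ i ∘ₗ LinearMap.piMap f =
      LinearMap.piMap fun j => f j ∘ₗ φ j i - ψ j i ∘ₗ f j := by ext v; simp
    rw [e]
    refine (Nat.cast_le.2 (rk_piMap_le _)).trans ?_
    push_cast
    exact Finset.sum_le_sum fun j _ => h3 j i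

theorem Near.copies [Module.Finite K V] [Module.Finite K W] (h : Near φ ψ c) (q : ℕ) :
    Near (copies q φ) (copies q ψ) (q * c) := by
  have := Near.directSum (J := Fin q) fun _ => h
  simpa [RankSpectrum.copies] using this

theorem near_copies_copies (φ : ι → Module.End K V) (a b : ℕ) :
    Near (copies a (copies b φ)) (copies (a * b) φ) 0 :=
  Near.of_equiv ((LinearEquiv.curry K V (Fin a) (Fin b)).symm.trans
    (LinearEquiv.funCongrLeft K V finProdFinEquiv.symm)) fun _ _ => rfl

theorem near_copies_directSum {J : Type*} {V : J → Type*} [∀ j, AddCommGroup (V j)]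
    [∀ j, Module K (V j)] (φ : ∀ j, ι → Module.End K (V j)) (q : ℕ) :
    Near (copies q (directSum φ)) (directSum fun j => copies q (φ j)) 0 :=
  Near.of_equiv
    { toFun := fun v j a => v a j
      invFun := fun v a j => v j a
      map_add' := fun _ _ => rfl
      map_smul' := fun _ _ => rfl
      left_inv := fun _ => rfl
      right_inv := fun _ => rfl } fun _ _ => rfl

/-- Extension by zero, or restriction, of `a`-tuples to `b`-tuples. -/
def padTuple (K V : Type*) [Field K] [AddCommGroup V] [Module K V] (a b : ℕ) :
    (Fin a → V) →ₗ[K] (Fin b → V) where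
  toFun v j := if h : (j : ℕ) < a then v ⟨j, h⟩ else 0
  map_add' v w := by
    ext j
    by_cases h : (j : ℕ) < a <;> simp [h]
  map_smul' c v := by
    ext j
    by_cases h : (j : ℕ) < a <;> simp [h]

theorem rk_padTuple_comp_sub_one_le [Module.Finite K V] (a b : ℕ) :
    rk (padTuple K V b a ∘ₗ padTuple K V a b - 1) ≤ (a - b) * Module.finrank K V := by
  have e : padTuple K V b a ∘ₗ padTuple K V a b - 1 =
      LinearMap.piMap fun j : Fin a => if (j : ℕ) < b then (0 : Module.End K V) else -1 := by
    refine LinearMap.ext fun v => funext fun j => ?_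
    by_cases h : (j : ℕ) < b <;> simp [padTuple, h]
  rw [e]
  refine (rk_piMap_le _).trans ?_
  have : ∀ j : Fin a, rk (if (j : ℕ) < b then (0 : Module.End K V) else -1) ≤
      if (j : ℕ) < b then 0 else Module.finrank K V := by
    intro j
    split_ifs
    · exact rk_zero.le
    · exact rk_le_domain _
  refine (Finset.sum_le_sum fun j _ => this j).trans ?_
  rw [Fin.sum_univ_eq_sum_range (fun j => if j < b then 0 else Module.finrank K V) a,
    Finset.sum_ite]
  simp only [Finset.sum_const_zero, zero_add, Finset.sum_const, smul_eq_mul]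
  gcongr
  have : Finset.filter (fun x => ¬ x < b) (Finset.range a) ⊆ Finset.Ico b a := by
    intro x; simp; omega
  exact (Finset.card_le_card this).trans (by simp)

/-- Changing the number of copies costs the difference of the dimensions. -/
theorem near_copies [Module.Finite K V] (φ : ι → Module.End K V) {a b : ℕ} {c : ℝ}
    (h : |(a * Module.finrank K V : ℝ) - b * Module.finrank K V| ≤ c) :
    Near (copies a φ) (copies b φ) c := by
  replace h : |(a : ℝ) - b| * Module.finrank K V ≤ c := by
    rwa [← sub_mul, abs_mul, Nat.abs_cast] at h
  have key : ∀ a b : ℕ, ((a - b : ℕ) : ℝ) ≤ |(a : ℝ) - b| := by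
    intro a b
    rcases le_total b a with h | h
    · rw [Nat.cast_sub h]; exact le_abs_self _
    · rw [Nat.sub_eq_zero_of_le h]; simp
  have hc : 0 ≤ c := le_trans (by positivity) h
  refine ⟨padTuple K V a b, padTuple K V b a, ?_, ?_, fun i => ?_⟩
  · refine (Nat.cast_le.2 (rk_padTuple_comp_sub_one_le b a)).trans (le_trans ?_ h)
    push_cast
    rw [abs_sub_comm]
    gcongr
    exact key b a
  · refine (Nat.cast_le.2 (rk_padTuple_comp_sub_one_le a b)).trans (le_trans ?_ h)
    push_cast
    gcongr
    exact key a b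
  · have e : padTuple K V a b ∘ₗ RankSpectrum.copies a φ i -
        RankSpectrum.copies b φ i ∘ₗ padTuple K V a b = 0 := by
      refine LinearMap.ext fun v => funext fun j => ?_
      by_cases h : (j : ℕ) < a <;> simp [padTuple, h]
    rw [e, rk_zero, Nat.cast_zero]
    exact hc

/-- An invariant subspace is near to the whole space up to its codimension. -/
theorem near_of_injective [Module.Finite K V] [Module.Finite K W] (f : V →ₗ[K] W)
    (hf : Function.Injective f) (h : ∀ i v, f (φ i v) = ψ i (f v)) :
    Near φ ψ (Module.finrank K W - Module.finrank K V) := by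
  obtain ⟨g, hg⟩ := f.exists_leftInverse_of_injective (LinearMap.ker_eq_bot.2 hf)
  have hd := LinearMap.finrank_le_finrank_of_injective hf
  have hc : (0 : ℝ) ≤ Module.finrank K W - Module.finrank K V := by
    rw [sub_nonneg]; exact_mod_cast hd
  refine ⟨f, g, ?_, ?_, fun i => ?_⟩
  · have hle : LinearMap.range (f ∘ₗ g - 1) ≤ LinearMap.ker g := by
      rintro _ ⟨w, rfl⟩
      have := LinearMap.congr_fun hg (g w)
      simp only [LinearMap.comp_apply, LinearMap.id_apply] at this
      simp [this]
    have h1 := Submodule.finrank_mono hle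
    have h2 := LinearMap.finrank_range_add_finrank_ker g
    have h3 : LinearMap.range g = ⊤ := LinearMap.range_eq_top.2 fun v =>
      ⟨f v, LinearMap.congr_fun hg v⟩
    rw [h3, finrank_top] at h2
    rw [le_sub_iff_add_le]
    norm_cast
    change Module.finrank K _ + _ ≤ _
    omega
  · rw [hg, show (LinearMap.id : V →ₗ[K] V) - 1 = 0 from sub_self _, rk_zero, Nat.cast_zero]
    exact hc
  · rw [show f ∘ₗ φ i - ψ i ∘ₗ f = 0 by ext v; simp [h], rk_zero, Nat.cast_zero]
    exact hc

/-- A family on `V` extends by zero to a family on any larger space. -/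
theorem exists_near_of_finrank_le [Module.Finite K V] [Module.Finite K W]
    (φ : ι → Module.End K V) (h : Module.finrank K V ≤ Module.finrank K W) :
    ∃ ψ : ι → Module.End K W, Near φ ψ (Module.finrank K W - Module.finrank K V) := by
  obtain ⟨f, hf⟩ : ∃ f : V →ₗ[K] W, Function.Injective f :=
    finrank_le_iff_exists_linearMap.1 h
  obtain ⟨g, hg⟩ := f.exists_leftInverse_of_injective (LinearMap.ker_eq_bot.2 hf)
  refine ⟨fun i => f ∘ₗ φ i ∘ₗ g, near_of_injective f hf fun i v => ?_⟩
  have := LinearMap.congr_fun hg v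
  simp only [LinearMap.comp_apply, LinearMap.id_apply] at this
  simp [this]

/-- On spaces of the same dimension, near families are conjugate up to small rank. -/
theorem Near.exists_equiv [Module.Finite K V] [Module.Finite K W] (h : Near φ ψ c)
    (hd : Module.finrank K V = Module.finrank K W) :
    ∃ e : V ≃ₗ[K] W, ∀ i, (rk (e.conj (φ i) - ψ i) : ℝ) ≤ 3 * c := by
  obtain ⟨f, g, -, h2, h3⟩ := h
  obtain ⟨e, he⟩ := exists_equiv_rk_sub_le hd f
  have hk := he.trans (finrank_ker_le_of_rk_sub_one_le (g := g) le_rfl)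
  refine ⟨e, fun i => ?_⟩
  have e1 : e.conj (φ i) - ψ i = ((e.toLinearMap - f) ∘ₗ φ i + (f ∘ₗ φ i - ψ i ∘ₗ f) -
      ψ i ∘ₗ (e.toLinearMap - f)) ∘ₗ e.symm.toLinearMap := by
    ext v; simp [LinearEquiv.conj_apply]
  have h4 : rk (e.conj (φ i) - ψ i) ≤ rk (e.toLinearMap - f) + rk (f ∘ₗ φ i - ψ i ∘ₗ f) +
      rk (e.toLinearMap - f) := by
    rw [e1]
    refine (rk_comp_le_left _ _).trans ((rk_sub_le _ _).trans (Nat.add_le_add ?_ ?_))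
    · exact (rk_add_le _ _).trans (Nat.add_le_add_right (rk_comp_le_left _ _) _)
    · exact rk_comp_le_right _ _
  have h5 : (rk (e.conj (φ i) - ψ i) : ℝ) ≤ rk (g ∘ₗ f - 1) + rk (f ∘ₗ φ i - ψ i ∘ₗ f) +
      rk (g ∘ₗ f - 1) := by
    norm_cast; omega
  linarith [h3 i]

end near

/-! ### Hyperfinite families and approximate periodicity -/

theorem exists_tendsto_of_mem_Icc {α : Type*} (ω : Ultrafilter α) {u : α → ℝ} {a b : ℝ}
    (h : ∀ n, u n ∈ Set.Icc a b) : ∃ x, Tendsto u ω (𝓝 x) := by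
  obtain ⟨x, -, hx⟩ := (isCompact_Icc (a := a) (b := b)).ultrafilter_le_nhds (ω.map u)
    (le_principal_iff.2 (Filter.mem_map.2 (Filter.univ_mem' h)))
  exact ⟨x, hx⟩

section hyperfinite

variable {K ι : Type*} [Field K] {V : ℕ → Type*} [∀ n, AddCommGroup (V n)]
  [∀ n, Module K (V n)] [∀ n, Module.Finite K (V n)]

/-- Hyperfiniteness up to small rank, for a sequence of families of endomorphisms of
finite-dimensional spaces: for each `ε` there are finitely many families `ν i` on coordinate
spaces such that the `n`-th family is near to a direct sum of copies of them, up to `ε` times its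
dimension. The multiplicities are required to be bounded as those of direct summands are. -/
def NearHyperfinite (φ : ∀ n, ι → Module.End K (V n)) : Prop :=
  ∀ ε : ℝ, 0 < ε → ∃ (t : ℕ) (p : Fin t → ℕ) (ν : ∀ i, ι → Module.End K (Fin (p i) → K)),
    ∀ n, ∃ α : Fin t → ℕ, (∀ i, α i * p i ≤ Module.finrank K (V n)) ∧
      Near (directSum fun i => copies (α i) (ν i)) (φ n) (ε * Module.finrank K (V n))

theorem finrank_tuple (K V : Type*) [Field K] [AddCommGroup V] [Module K V] [Module.Finite K V]
    (q : ℕ) : Module.finrank K (Fin q → V) = q * Module.finrank K V := by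
  simp [Module.finrank_pi_fintype]

theorem near_copies_directSum_copies {J : Type*} [Fintype J] {p : J → ℕ}
    (ν : ∀ i, ι → Module.End K (Fin (p i) → K)) (q : ℕ) (α : J → ℕ) :
    Near (copies q (directSum fun i => copies (α i) (ν i)))
      (directSum fun i => copies (q * α i) (ν i)) 0 := by
  have h3 := near_copies_directSum (fun i => copies (α i) (ν i)) q
  have h4 := Near.directSum fun i => near_copies_copies (ν i) q (α i)
  simpa using h3.trans h4

theorem NearHyperfinite.tuple {φ : ∀ n, ι → Module.End K (V n)} (h : NearHyperfinite φ)
    (q : ℕ → ℕ) : NearHyperfinite fun n => copies (q n) (φ n) := by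
  intro ε hε
  obtain ⟨t, p, ν, H⟩ := h ε hε
  refine ⟨t, p, ν, fun n => ?_⟩
  obtain ⟨α, h1, h2⟩ := H n
  refine ⟨fun i => q n * α i, fun i => ?_, ?_⟩
  · rw [finrank_tuple, mul_assoc]
    exact Nat.mul_le_mul_left _ (h1 i)
  · refine ((near_copies_directSum_copies ν (q n) α).symm.trans
      (h2.copies (q n))).mono (le_of_eq ?_)
    rw [finrank_tuple]
    push_cast
    ring

/-- The key consequence of hyperfiniteness: along an ultrafilter for which the dimensions tend to
infinity, almost every member `m` of the sequence has the property that almost every member `n` is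
nearly a direct sum of copies of the `m`-th one. Indeed the proportions of the multiplicities
converge along the ultrafilter. -/
theorem NearHyperfinite.eventually_near {φ : ∀ n, ι → Module.End K (V n)}
    (h : NearHyperfinite φ) {ω : Ultrafilter ℕ}
    (hd : Tendsto (fun n => Module.finrank K (V n)) ω atTop) {ε : ℝ} (hε : 0 < ε) :
    ∀ᶠ m in ω, ∀ᶠ n in ω,
      Near (copies (Module.finrank K (V n) / Module.finrank K (V m)) (φ m)) (φ n)
        (ε * Module.finrank K (V n)) := by
  obtain ⟨t, p, ν, H⟩ := h (ε / 8) (by positivity)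
  choose α hα hN using H
  set D : ℕ → ℕ := fun n => Module.finrank K (V n) with hD
  have hdR : Tendsto (fun n => (D n : ℝ)) ω atTop := tendsto_natCast_atTop_atTop.comp hd
  have hw : ∀ i, ∃ w, Tendsto (fun n => ((α n i * p i : ℕ) : ℝ) / D n) ω (𝓝 w) := fun i =>
    exists_tendsto_of_mem_Icc ω (a := 0) (b := 1) fun n =>
      ⟨by positivity, div_le_one_of_le₀ (by exact_mod_cast hα n i) (by positivity)⟩
  choose w hw using hw
  -- the tolerance for the proportions and for the rounding of the number of copies
  obtain ⟨η, hη, hηε⟩ : ∃ η : ℝ, 0 < η ∧ t * (3 * η) ≤ 3 * ε / 8 := by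
    refine ⟨ε / (8 * (t + 1)), by positivity, ?_⟩
    have : (t : ℝ) / (t + 1) ≤ 1 := div_le_one_of_le₀ (by linarith) (by positivity)
    calc (t : ℝ) * (3 * (ε / (8 * (t + 1)))) = 3 * ε / 8 * (t / (t + 1)) := by
          field_simp
      _ ≤ 3 * ε / 8 * 1 := by gcongr
      _ = _ := by ring
  have hev : ∀ᶠ n in ω, (∀ i, |((α n i * p i : ℕ) : ℝ) / D n - w i| < η) ∧ 0 < D n := by
    refine (eventually_all.2 fun i => ?_).and (hd.eventually_gt_atTop 0)
    simpa [Real.dist_eq] using Metric.tendsto_nhds.1 (hw i) η hη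
  filter_upwards [hev] with m hm
  filter_upwards [hev, hdR.eventually_ge_atTop ((D m : ℝ) / η)] with n hn hmn
  rw [div_le_iff₀ hη] at hmn
  have hDm : (0 : ℝ) < D m := by exact_mod_cast hm.2
  have hDn : (0 : ℝ) < D n := by exact_mod_cast hn.2
  set q := D n / D m with hq
  have hq1 : (q : ℝ) * D m ≤ D n := by exact_mod_cast Nat.div_mul_le_self _ _
  have hq2 : (D n : ℝ) - D m ≤ q * D m := by
    have := Nat.lt_div_mul_add (a := D n) hm.2
    have : (D n : ℝ) < q * D m + D m := by exact_mod_cast this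
    linarith
  have hi : ∀ i, Near (copies (q * α m i) (ν i)) (copies (α n i) (ν i))
      (3 * η * D n) := by
    intro i
    apply near_copies
    rw [Module.finrank_fin_fun]
    have h1 := abs_lt.1 (hm.1 i)
    have h2 := abs_lt.1 (hn.1 i)
    set a := ((α m i * p i : ℕ) : ℝ) / D m
    set b := ((α n i * p i : ℕ) : ℝ) / D n
    have ea : (α m i : ℝ) * p i = a * D m := by simp [a]; field_simp
    have eb : (α n i : ℝ) * p i = b * D n := by simp [b]; field_simp
    have ha0 : 0 ≤ a := by positivity
    have ha1 : a ≤ 1 := div_le_one_of_le₀ (by exact_mod_cast hα m i) hDm.le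
    have e : ((q * α m i : ℕ) : ℝ) * p i - α n i * p i =
        a * (q * D m - D n) + (a - b) * D n := by
      push_cast
      linear_combination (q : ℝ) * ea - eb
    rw [e]
    refine (abs_add_le _ _).trans ?_
    rw [abs_mul, abs_mul, abs_of_nonneg ha0, abs_of_pos hDn]
    have h3 : |(q : ℝ) * D m - D n| ≤ η * D n := by rw [abs_le]; constructor <;> linarith
    have h4 : |a - b| ≤ 2 * η := by rw [abs_le]; constructor <;> linarith
    have h5 : a * |(q : ℝ) * D m - D n| ≤ 1 * (η * D n) := by gcongr
    have h6 : |a - b| * D n ≤ 2 * η * D n := by gcongr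
    linarith
  refine ((((hN m).symm.copies q).trans (near_copies_directSum_copies ν q (α m))).trans
    ((Near.directSum hi).trans (hN n))).mono ?_
  simp only [Finset.sum_const, Finset.card_univ, Fintype.card_fin, nsmul_eq_mul]
  have h1 : (q : ℝ) * (3 * (ε / 8 * D m)) ≤ 3 * ε / 8 * D n := by
    calc (q : ℝ) * (3 * (ε / 8 * D m)) = 3 * ε / 8 * (q * D m) := by ring
      _ ≤ _ := by gcongr
  have h2 : (t : ℝ) * (3 * η * D n) ≤ 3 * ε / 8 * D n := by
    calc (t : ℝ) * (3 * η * D n) = t * (3 * η) * D n := by ring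
      _ ≤ _ := by gcongr
  change (q : ℝ) * (3 * (ε / 8 * D m)) + 0 + (t * (3 * η * D n) + ε / 8 * D n) ≤ ε * D n
  nlinarith [mul_pos hε hDn]

end hyperfinite

/-! ### Modules as families of endomorphisms -/

/-- The family of the multiplications by the elements of `R` on an `R`-module. -/
def act (K R M : Type*) [Field K] [Ring R] [Algebra K R] [AddCommGroup M] [Module K M]
    [Module R M] [IsScalarTower K R M] : R → Module.End K M :=
  Algebra.lsmul K K M

@[simp] theorem act_apply {K R M : Type*} [Field K] [Ring R] [Algebra K R] [AddCommGroup M]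
    [Module K M] [Module R M] [IsScalarTower K R M] (r : R) (v : M) : act K R M r v = r • v := rfl

/-- A finitely generated `R`-module in coordinates over `K`, which acts through `algebraMap`. -/
theorem exists_addEquiv_coordinates (K : Type*) {R : Type*} [Field K] [Ring R] [Algebra K R]
    [Module.Finite K R] (N : Type*) [AddCommGroup N] [Module R N] [Module.Finite R N] :
    ∃ (p : ℕ) (ν : R → Module.End K (Fin p → K)) (e : N ≃+ (Fin p → K)),
      (∀ r x, e (r • x) = ν r (e x)) ∧ ∀ (c : K) x, e (algebraMap K R c • x) = c • e x := by
  let : Module K N := Module.compHom N (algebraMap K R)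
  have : IsScalarTower K R N := IsScalarTower.of_algebraMap_smul fun _ _ => rfl
  have : Module.Finite K N := Module.Finite.trans R N
  let e := (Module.finBasis K N).equivFun
  refine ⟨_, fun r => e.conj (act K R N r), e.toAddEquiv, fun r x => ?_, fun c x => ?_⟩
  · simp [LinearEquiv.conj_apply]
  · exact e.map_smul c x

theorem Hyperfinite.nearHyperfinite {K R : Type*} [Field K] [Ring R] [Algebra K R]
    [Module.Finite K R] {M : ℕ → Type*} [∀ n, AddCommGroup (M n)] [∀ n, Module K (M n)]
    [∀ n, Module R (M n)] [∀ n, IsScalarTower K R (M n)] [∀ n, Module.Finite K (M n)]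
    (h : Hyperfinite K R M) : NearHyperfinite fun n => act K R (M n) := by
  intro ε hε
  obtain ⟨t, N, hN, H⟩ := h ε hε
  choose p ν e he1 he2 using fun i => exists_addEquiv_coordinates K (R := R) (N i)
  refine ⟨t, p, ν, fun n => ?_⟩
  obtain ⟨P, α, hP, ⟨f⟩⟩ := H n
  have hcast : ∀ (c : K) (x : P), c • x = algebraMap K R c • x := fun c x =>
    (algebraMap_smul R c x).symm
  -- the given decomposition of `P`, in coordinates and as a `K`-linear map
  let g : P ≃ₗ[K] ∀ i, Fin (α i) → Fin (p i) → K :=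
    { toFun := fun x i a => e i (f x i a)
      invFun := fun y => f.symm fun i a => (e i).symm (y i a)
      map_add' := fun x y => by ext; simp
      map_smul' := fun c x => by
        funext i a
        simp only [RingHom.id_apply, Pi.smul_apply]
        rw [hcast, map_smul]
        exact he2 i c _
      left_inv := fun x => by simp
      right_inv := fun y => by simp }
  let j : (∀ i, Fin (α i) → Fin (p i) → K) →ₗ[K] M n :=
    (P.restrictScalars K).subtype ∘ₗ g.symm.toLinearMap
  have hj : Function.Injective j := Subtype.val_injective.comp g.symm.injective
  have hfin : Module.finrank K (∀ i, Fin (α i) → Fin (p i) → K) = ∑ i, α i * p i := by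
    simp [Module.finrank_pi_fintype]
  have hPfin : Module.finrank K P = Module.finrank K (∀ i, Fin (α i) → Fin (p i) → K) :=
    g.finrank_eq
  have hle := LinearMap.finrank_le_finrank_of_injective hj
  refine ⟨α, fun i => ?_, ?_⟩
  · rw [hfin] at hle
    exact (Finset.single_le_sum (f := fun i => α i * p i) (fun _ _ => Nat.zero_le _)
      (Finset.mem_univ i)).trans hle
  · refine (near_of_injective j hj fun r v => ?_).mono ?_
    · have hg : ∀ x : P, g (r • x) = directSum (fun i => copies (α i) (ν i)) r (g x) := by
        intro x
        funext i a
        simp only [directSum_apply, copies_apply]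
        change e i (f (r • x) i a) = ν i r (e i (f x i a))
        rw [map_smul, ← he1]
        rfl
      obtain ⟨x, rfl⟩ := g.surjective v
      rw [← hg]
      change ((g.symm (g (r • x)) : P) : M n) = r • ((g.symm (g x) : P) : M n)
      simp
    · rw [← hPfin]
      linarith

/-! ### Dyadic models -/

section dyadic

variable {K ι : Type*} [Field K]

/-- The family of endomorphisms of the coordinate space given by a family of matrices. -/
def dyadicSystem {s : ℕ} (T : ι → Dyadic K s) (i : ι) : Module.End K (Fin (2 ^ s) → K) :=
  Matrix.toLin' (T i)

/-- The diagonal embedding is, up to a permutation of the coordinates, a direct sum of copies. -/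
theorem near_dyadicSystem_diagEmb {s s' : ℕ} (h : s ≤ s') (T : ι → Dyadic K s) :
    Near (dyadicSystem fun i => diagEmb K h (T i)) (copies (2 ^ (s' - s)) (dyadicSystem T)) 0 := by
  let e : (Fin (2 ^ s') → K) ≃ₗ[K] (Fin (2 ^ (s' - s)) → Fin (2 ^ s) → K) :=
    (LinearEquiv.funCongrLeft K K ((Equiv.prodComm _ _).trans (blockEquiv h))).trans
      (LinearEquiv.curry K K _ _)
  have he : ∀ v b a, e v b a = v (blockEquiv h (a, b)) := fun _ _ _ => rfl
  refine Near.of_equiv e fun i v => ?_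
  funext b a
  rw [he, copies_apply]
  simp only [dyadicSystem, Matrix.toLin'_apply, Matrix.mulVec, dotProduct]
  rw [← (blockEquiv h).sum_comp, Fintype.sum_prod_type]
  have hd : ∀ x y, diagEmb K h (T i) (blockEquiv h x) (blockEquiv h y) =
      Matrix.blockDiagonal (fun _ : Fin (2 ^ (s' - s)) => T i) x y := by
    intro x y
    have e : ∀ x y, diagEmb K h (T i) x y =
      Matrix.blockDiagonal (fun _ : Fin (2 ^ (s' - s)) => T i)
        ((blockEquiv h).symm x) ((blockEquiv h).symm y) := fun _ _ => rfl
    simp [e]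
  simp [hd, Matrix.blockDiagonal_apply, he]

theorem matRank_single {s : ℕ} (A : Dyadic K s) :
    matRank (Matrix.of fun _ _ : Fin 1 => A) = (A.rank : ℝ) / 2 ^ s := by
  rw [matRank]
  congr 2
  have : Matrix.comp (Fin 1) (Fin 1) (Fin (2 ^ s)) (Fin (2 ^ s)) K
      (Matrix.of fun _ _ : Fin 1 => A) = A.submatrix (Equiv.uniqueProd _ _)
        (Equiv.uniqueProd _ _) := by
    ext ⟨a, x⟩ ⟨b, y⟩
    rfl
  rw [this, Matrix.rank_submatrix]

theorem dist_level {s : ℕ} (A B : Dyadic K s) :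
    dist (level K s A) (level K s B) = ((A - B).rank : ℝ) / 2 ^ s := by
  rw [dist_def, ← map_sub, ← matRank_single, ← limRank_map]
  rfl

end dyadic

/-! ### Comparing numbers of copies -/

section resize

variable {K ι V W : Type*} [Field K] [AddCommGroup V] [Module K V] [AddCommGroup W] [Module K W]
  [Module.Finite K V] [Module.Finite K W]

theorem cast_div_mul_le (a b : ℕ) : ((a / b : ℕ) : ℝ) * b ≤ a := by
  exact_mod_cast Nat.div_mul_le_self a b

theorem sub_le_cast_div_mul (a : ℕ) {b : ℕ} (hb : 0 < b) :
    (a : ℝ) - b ≤ ((a / b : ℕ) : ℝ) * b := by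
  have := Nat.lt_div_mul_add (a := a) hb
  have : (a : ℝ) < (a / b : ℕ) * b + b := by exact_mod_cast this
  linarith

/-- If `φ` is nearly a direct sum of copies of `T`, and `ψ` nearly one of copies of `φ`, then `ψ`
is near to the image of `T` under the diagonal embedding. -/
theorem near_diagEmb_of_near {s s' : ℕ} (hs : s ≤ s') {T : ι → Dyadic K s}
    {φ : ι → Module.End K V} {ψ : ι → Module.End K W} {ε η : ℝ} {d : ℕ} (hd : 0 < d)
    (hε : 0 ≤ ε) (hφ : Near (copies (d / 2 ^ s) (dyadicSystem T)) φ (ε * d))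
    (hψ : Near (copies (2 ^ s' / d) φ) ψ (η * 2 ^ s'))
    (h1 : (2 : ℝ) ^ s ≤ η * d) (h2 : (d : ℝ) ≤ η * 2 ^ s') :
    Near (dyadicSystem fun i => diagEmb K hs (T i)) ψ ((ε + 3 * η) * 2 ^ s') := by
  have hb1 := cast_div_mul_le (2 ^ s') d
  have hb2 := sub_le_cast_div_mul (2 ^ s') hd
  have hc1 := cast_div_mul_le d (2 ^ s)
  have hc2 := sub_le_cast_div_mul d (b := 2 ^ s) (by positivity)
  generalize 2 ^ s' / d = b at *
  generalize d / 2 ^ s = c at *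
  have hb0 : (0 : ℝ) ≤ b := Nat.cast_nonneg b
  have hη : 0 ≤ η := by
    by_contra hneg
    have : η * 2 ^ s' ≤ 0 := mul_nonpos_of_nonpos_of_nonneg (not_le.1 hneg).le (by positivity)
    have : (0 : ℝ) < d := by exact_mod_cast hd
    linarith
  push_cast at hb1 hb2 hc1 hc2
  have h3 : Near (copies (2 ^ (s' - s)) (dyadicSystem T)) (copies (b * c) (dyadicSystem T))
      (2 * η * 2 ^ s') := by
    apply near_copies
    rw [Module.finrank_fin_fun]
    have e1 : (2 : ℝ) ^ (s' - s) * 2 ^ s = 2 ^ s' := by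
      rw [← pow_add, Nat.sub_add_cancel hs]
    push_cast
    rw [e1]
    have h3 : (b : ℝ) * (c * 2 ^ s) ≤ b * d := by gcongr
    have h4 : (b : ℝ) * (d - 2 ^ s) ≤ b * (c * 2 ^ s) := by gcongr
    have h5 : (b : ℝ) * 2 ^ s ≤ b * (η * d) := by gcongr
    have h6 : η * (b * d) ≤ η * 2 ^ s' := by gcongr
    have h7 : 0 ≤ η * 2 ^ s' := by positivity
    rw [abs_le]
    constructor <;> linarith
  refine (((((near_dyadicSystem_diagEmb hs T).trans h3).trans
    (near_copies_copies _ _ _).symm).trans (hφ.copies b)).trans hψ).mono ?_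
  have h4 : ε * (b * d) ≤ ε * 2 ^ s' := by gcongr
  linarith

/-- If `ψ` and `χ` are both nearly direct sums of copies of `φ`, then `χ` is nearly a direct sum
of copies of `ψ`. -/
theorem near_copies_of_near {X : Type*} [AddCommGroup X] [Module K X] [Module.Finite K X]
    {φ : ι → Module.End K V} {ψ : ι → Module.End K W} {χ : ι → Module.End K X} {η : ℝ}
    {d N D : ℕ} (hV : Module.finrank K V = d) (hd : 0 < d) (hN : 0 < N) (hη : 0 ≤ η)
    (hψ : Near (copies (N / d) φ) ψ (η * N)) (hχ : Near (copies (D / d) φ) χ (η * D))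
    (h1 : (d : ℝ) ≤ η * N) (h2 : (N : ℝ) ≤ η * D) (h3 : (d : ℝ) ≤ η * D) :
    Near (copies (D / N) ψ) χ (6 * η * D) := by
  have hb1 := cast_div_mul_le N d
  have hb2 := sub_le_cast_div_mul N hd
  have hc1 := cast_div_mul_le D d
  have hc2 := sub_le_cast_div_mul D hd
  have hq1 := cast_div_mul_le D N
  have hq2 := sub_le_cast_div_mul D hN
  generalize N / d = b at *
  generalize D / d = c at *
  generalize D / N = q at *
  have hq0 : (0 : ℝ) ≤ q := Nat.cast_nonneg q
  have h4 : Near (copies (q * b) φ) (copies c φ) (2 * η * D) := by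
    apply near_copies
    rw [hV]
    push_cast
    have h3 : (q : ℝ) * (b * d) ≤ q * N := by gcongr
    have h4 : (q : ℝ) * (N - d) ≤ q * (b * d) := by gcongr
    have h5 : (q : ℝ) * d ≤ q * (η * N) := by gcongr
    have h6 : η * (q * N) ≤ η * D := by gcongr
    have h7 : 0 ≤ η * D := by positivity
    rw [abs_le]
    constructor <;> linarith
  refine ((((hψ.symm.copies q).trans (near_copies_copies _ _ _)).trans h4).trans hχ).mono ?_
  have h5 : η * (q * N) ≤ η * D := by gcongr
  linarith

theorem rank_eq_rk_toLin' {m n : ℕ} (A : Matrix (Fin m) (Fin n) K) :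
    A.rank = rk (Matrix.toLin' A) := rfl

end resize

/-! ### Refining models -/

section step

variable {K ι : Type*} [Field K] {V : ℕ → Type*} [∀ n, AddCommGroup (V n)]
  [∀ n, Module K (V n)] [∀ n, Module.Finite K (V n)]

/-- A family `T` of dyadic matrices models the sequence `φ` along `ω` up to `ε` if almost every
`φ n` is nearly a direct sum of copies of `T`. -/
def IsModel (ω : Ultrafilter ℕ) (φ : ∀ n, ι → Module.End K (V n)) (s : ℕ) (T : ι → Dyadic K s)
    (ε : ℝ) : Prop :=
  ∀ᶠ n in ω, Near (copies (Module.finrank K (V n) / 2 ^ s) (dyadicSystem T)) (φ n)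
    (ε * Module.finrank K (V n))

/-- With error `1` there is no condition on a model, which starts the construction. -/
theorem isModel_zero (ω : Ultrafilter ℕ) (φ : ∀ n, ι → Module.End K (V n)) :
    IsModel ω φ 0 0 1 := by
  refine Eventually.of_forall fun n => ⟨0, 0, ?_, ?_, fun i => ?_⟩
  · rw [one_mul]
    exact_mod_cast rk_le_domain _
  · rw [one_mul]
    refine Nat.cast_le.2 ((rk_le_domain _).trans (le_of_eq ?_))
    rw [finrank_tuple]
    simp
  · rw [LinearMap.zero_comp, LinearMap.comp_zero, sub_zero, rk_zero, one_mul]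
    simp

/-- A model can be refined: a better, suitably conjugated model of larger size is close to the
image of the given one under the diagonal embedding. -/
theorem IsModel.exists_refinement {ω : Ultrafilter ℕ} {φ : ∀ n, ι → Module.End K (V n)}
    (h : NearHyperfinite φ) (hd : Tendsto (fun n => Module.finrank K (V n)) ω atTop) {s : ℕ}
    {T : ι → Dyadic K s} {ε ε' : ℝ} (hε : 0 ≤ ε) (hT : IsModel ω φ s T ε) (hε' : 0 < ε') :
    ∃ (s' : ℕ) (hs : s ≤ s') (T' : ι → Dyadic K s'), IsModel ω φ s' T' ε' ∧
      ∀ i, ((diagEmb K hs (T i) - T' i).rank : ℝ) ≤ 3 * (ε + ε') * 2 ^ s' := by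
  have hdR : Tendsto (fun n => (Module.finrank K (V n) : ℝ)) ω atTop :=
    tendsto_natCast_atTop_atTop.comp hd
  obtain ⟨η, hη, rfl⟩ : ∃ η : ℝ, 0 < η ∧ ε' = 6 * η := ⟨ε' / 6, by positivity, by ring⟩
  -- one member of the sequence that is modelled by `T` and in turn models the sequence
  obtain ⟨m, hm1, hm2, hm3, hm4⟩ := (hT.and ((h.eventually_near hd hη).and
    ((hdR.eventually_ge_atTop (2 ^ s / η)).and (hd.eventually_gt_atTop 0)))).exists
  rw [div_le_iff₀' hη] at hm3
  obtain ⟨s', hs, hs'⟩ : ∃ s', s ≤ s' ∧ (Module.finrank K (V m) : ℝ) ≤ η * 2 ^ s' := by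
    have h1 : Tendsto (fun k : ℕ => η * (2 : ℝ) ^ k) atTop atTop :=
      (tendsto_pow_atTop_atTop_of_one_lt one_lt_two).const_mul_atTop hη
    exact ((eventually_ge_atTop s).and (h1.eventually_ge_atTop _)).exists
  -- the member, repeated to fill up a space of dyadic dimension
  obtain ⟨ψ, hψ⟩ := exists_near_of_finrank_le (W := Fin (2 ^ s') → K)
    (copies (2 ^ s' / Module.finrank K (V m)) (φ m)) (by
      rw [finrank_tuple, Module.finrank_fin_fun]
      exact Nat.div_mul_le_self _ _)
  replace hψ : Near (copies (2 ^ s' / Module.finrank K (V m)) (φ m)) ψ (η * 2 ^ s') := by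
    refine hψ.mono ?_
    have := sub_le_cast_div_mul (2 ^ s') hm4
    rw [Module.finrank_fin_fun, finrank_tuple]
    push_cast at this ⊢
    linarith
  obtain ⟨e, he⟩ := (near_diagEmb_of_near hs hm4 hε hm1 hψ hm3 hs').exists_equiv rfl
  -- conjugating the new model makes it close to the diagonal image of the old one
  let T' : ι → Dyadic K s' := fun i => LinearMap.toMatrix' (e.symm.conj (ψ i))
  have hT' : ∀ i, dyadicSystem T' i = e.symm.conj (ψ i) := fun i => Matrix.toLin'_toMatrix' _
  have hT2 : Near ψ (dyadicSystem T') 0 := Near.of_equiv e.symm fun i v => by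
    rw [hT']
    simp [LinearEquiv.conj_apply]
  refine ⟨s', hs, T', ?_, fun i => ?_⟩
  · have hT3 : Near (copies (2 ^ s' / Module.finrank K (V m)) (φ m)) (dyadicSystem T')
        (η * (2 ^ s' : ℕ)) := by
      simpa using hψ.trans hT2
    filter_upwards [hm2, hdR.eventually_ge_atTop (2 ^ s' / η),
      hdR.eventually_ge_atTop (Module.finrank K (V m) / η)] with n hn1 hn2 hn3
    rw [div_le_iff₀' hη] at hn2 hn3
    exact near_copies_of_near rfl hm4 (by positivity) hη.le hT3 hn1 (by simpa using hs')
      (by simpa using hn2) hn3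
  · have h1 : (diagEmb K hs (T i) - T' i).rank =
        rk (e.conj (dyadicSystem (fun i => diagEmb K hs (T i)) i) - ψ i) := by
      rw [← rk_conj e.symm, map_sub, ← hT']
      have h2 : e.symm.conj (e.conj (dyadicSystem (fun i => diagEmb K hs (T i)) i)) =
          dyadicSystem (fun i => diagEmb K hs (T i)) i :=
        LinearMap.ext fun v => by simp [LinearEquiv.conj_apply]
      rw [h2, dyadicSystem, dyadicSystem, ← map_sub, rank_eq_rk_toLin']
    rw [h1]
    refine (he i).trans ?_
    have : 0 ≤ η * 2 ^ s' := by positivity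
    linarith

/-- Successive refinement yields a sequence of models of increasing precision that is a Cauchy
sequence in the direct limit. -/
theorem NearHyperfinite.exists_models {ω : Ultrafilter ℕ} {φ : ∀ n, ι → Module.End K (V n)}
    (h : NearHyperfinite φ) (hd : Tendsto (fun n => Module.finrank K (V n)) ω atTop) :
    ∃ (s : ℕ → ℕ) (T : ∀ m, ι → Dyadic K (s m)), Monotone s ∧
      (∀ m, IsModel ω φ (s m) (T m) ((1 / 2) ^ m)) ∧
      ∀ m i, dist (level K (s m) (T m i)) (level K (s (m + 1)) (T (m + 1) i)) ≤
        9 / 2 * (1 / 2) ^ m := by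
  let P : ℕ → (Σ s, ι → Dyadic K s) → Prop := fun m x => IsModel ω φ x.1 x.2 ((1 / 2) ^ m)
  have hstep : ∀ m (x : {x // P m x}), ∃ y : {y // P (m + 1) y}, ∃ hs : x.1.1 ≤ y.1.1,
      ∀ i, ((diagEmb K hs (x.1.2 i) - y.1.2 i).rank : ℝ) ≤ 9 / 2 * (1 / 2) ^ m * 2 ^ y.1.1 := by
    rintro m ⟨⟨s, T⟩, hT⟩
    obtain ⟨s', hs, T', h1, h2⟩ := IsModel.exists_refinement h hd (by positivity) hT
      (show (0 : ℝ) < (1 / 2) ^ (m + 1) by positivity)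
    refine ⟨⟨⟨s', T'⟩, h1⟩, hs, fun i => (h2 i).trans (le_of_eq ?_)⟩
    ring
  choose F hF1 hF2 using hstep
  let x : ∀ m, {x // P m x} := fun m => Nat.rec ⟨⟨0, 0⟩, by
    simpa [P] using isModel_zero ω φ⟩ (fun m x => F m x) m
  have hx : ∀ m, x (m + 1) = F m (x m) := fun m => rfl
  refine ⟨fun m => (x m).1.1, fun m => (x m).1.2, monotone_nat_of_le_succ fun m => ?_,
    fun m => (x m).2, fun m i => ?_⟩
  · rw [hx]
    exact hF1 m (x m)
  · change dist (level K _ ((x m).1.2 i)) (level K _ ((F m (x m)).1.2 i)) ≤ _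
    rw [← level_diagEmb (hF1 m (x m)), dist_level, div_le_iff₀ (by positivity)]
    exact hF2 m (x m) i

end step

/-! ### Matrices of endomorphisms -/

section matrix

variable {K V W : Type*} [Field K] [AddCommGroup V] [Module K V] [AddCommGroup W] [Module K W]

theorem endRank_eq (a : Module.End K V) : endRank a = (rk a : ℝ) / Module.finrank K V := rfl

theorem endMatRank_eq {k l : ℕ} (A : Matrix (Fin k) (Fin l) (Module.End K V)) :
    endMatRank A = (rk (matAct A) : ℝ) / Module.finrank K V := rfl

@[simp] theorem matAct_apply {k l : ℕ} (A : Matrix (Fin k) (Fin l) (Module.End K V))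
    (v : Fin l → V) (i : Fin k) : matAct A v i = ∑ j, A i j (v j) := by
  simp [matAct]

theorem endMatRank_nonneg {k l : ℕ} (A : Matrix (Fin k) (Fin l) (Module.End K V)) :
    0 ≤ endMatRank A := by
  rw [endMatRank_eq]; positivity

section finite

variable [Module.Finite K V]

theorem endMatRank_le {k l : ℕ} (A : Matrix (Fin k) (Fin l) (Module.End K V)) :
    endMatRank A ≤ k := by
  rw [endMatRank_eq]
  refine div_le_of_le_mul₀ (by positivity) (by positivity) ?_
  rw [← Nat.cast_mul, ← finrank_tuple]
  exact_mod_cast rk_le_codomain _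

theorem rk_matAct_le {k l : ℕ} (A : Matrix (Fin k) (Fin l) (Module.End K V)) :
    rk (matAct A) ≤ ∑ i, ∑ j, rk (A i j) := by
  have h : matAct A = ∑ i, ∑ j,
      LinearMap.single K (fun _ => V) i ∘ₗ A i j ∘ₗ LinearMap.proj j := by
    refine LinearMap.ext fun v => funext fun i => ?_
    simp [Finset.sum_apply, Pi.single_apply, Finset.sum_ite_irrel]
  rw [h]
  refine (rk_sum_le _ _).trans (Finset.sum_le_sum fun i _ =>
    (rk_sum_le _ _).trans (Finset.sum_le_sum fun j _ => ?_))
  exact (rk_comp_le_right _ _).trans (rk_comp_le_left _ _)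

theorem abs_endMatRank_sub_le {k l : ℕ} (A B : Matrix (Fin k) (Fin l) (Module.End K V)) :
    |endMatRank A - endMatRank B| ≤ ∑ i, ∑ j, endRank (A i j - B i j) := by
  have key : ∀ A B : Matrix (Fin k) (Fin l) (Module.End K V),
      endMatRank A - endMatRank B ≤ ∑ i, ∑ j, endRank (A i j - B i j) := by
    intro A B
    have h : matAct A = matAct (A - B) + matAct B := by
      refine LinearMap.ext fun v => funext fun i => ?_
      simp
    have h1 : rk (matAct A) ≤ ∑ i, ∑ j, rk (A i j - B i j) + rk (matAct B) := by
      rw [h]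
      exact (rk_add_le _ _).trans (Nat.add_le_add_right (rk_matAct_le _) _)
    simp only [endMatRank_eq, endRank_eq, ← Finset.sum_div, ← sub_div]
    gcongr
    rw [sub_le_iff_le_add]
    exact_mod_cast h1
  rw [abs_le]
  refine ⟨?_, key A B⟩
  have h1 := key B A
  have h2 : ∀ i j, endRank (B i j - A i j) = endRank (A i j - B i j) := fun i j => by
    rw [endRank_eq, rk_sub_comm, endRank_eq]
  simp only [h2] at h1
  linarith

end finite

theorem rk_matAct_single (a : Module.End K V) :
    rk (matAct (Matrix.of fun _ _ : Fin 1 => a)) = rk a := by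
  let e : (Fin 1 → V) ≃ₗ[K] V := LinearEquiv.funUnique (Fin 1) K V
  have h : matAct (Matrix.of fun _ _ : Fin 1 => a) =
      e.symm.toLinearMap ∘ₗ a ∘ₗ e.toLinearMap := by
    refine LinearMap.ext fun v => funext fun i => ?_
    simp [e, Subsingleton.elim i 0]
  rw [h, rk_comp_of_injective e.symm.injective, rk_comp_of_surjective _ e.surjective]

theorem rk_matAct_conj (e : V ≃ₗ[K] W) {k l : ℕ}
    (A : Matrix (Fin k) (Fin l) (Module.End K V)) :
    rk (matAct (A.map e.conj)) = rk (matAct A) := by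
  let a : (Fin l → V) ≃ₗ[K] (Fin l → W) := LinearEquiv.piCongrRight fun _ => e
  let b : (Fin k → V) ≃ₗ[K] (Fin k → W) := LinearEquiv.piCongrRight fun _ => e
  have h : matAct (A.map e.conj) = b.toLinearMap ∘ₗ matAct A ∘ₗ a.symm.toLinearMap := by
    refine LinearMap.ext fun v => funext fun i => ?_
    simp [a, b, LinearEquiv.conj_apply]
  rw [h, rk_comp_of_injective b.injective, rk_comp_of_surjective _ a.symm.surjective]

/-- The rank in terms of blocks, `matRank`, and the rank of the action on tuples agree. -/
theorem rk_matAct_toLin' {k l s : ℕ} (A : Matrix (Fin k) (Fin l) (Dyadic K s)) :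
    (rk (matAct (A.map fun B => (Matrix.toLin' B : Module.End K (Fin (2 ^ s) → K)))) : ℝ) =
      matRank A * 2 ^ s := by
  rw [matRank, div_mul_cancel₀ _ (by positivity)]
  congr 1
  let a := LinearEquiv.curry K K (Fin l) (Fin (2 ^ s))
  let b := LinearEquiv.curry K K (Fin k) (Fin (2 ^ s))
  have h : b.symm.toLinearMap ∘ₗ
      matAct (A.map fun B => (Matrix.toLin' B : Module.End K (Fin (2 ^ s) → K))) ∘ₗ
      a.toLinearMap = (Matrix.comp (Fin k) (Fin l) (Fin (2 ^ s)) (Fin (2 ^ s)) K A).mulVecLin := by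
    refine LinearMap.ext fun v => funext fun ⟨i, x⟩ => ?_
    simp [a, b, Matrix.mulVec, dotProduct, Fintype.sum_prod_type, Finset.sum_apply]
  rw [Matrix.rank, ← h]
  change _ = rk _
  rw [rk_comp_of_injective b.symm.injective, rk_comp_of_surjective _ a.surjective]

end matrix

/-! ### Inflation of dyadic matrices to a given size -/

section inflate

variable {K : Type*} [Field K]

/-- A linear map whose values vanish on the first `c` coordinates has small rank. -/
theorem rk_le_of_forall_lt {V : Type*} [AddCommGroup V] [Module K V] {d : ℕ} (c : ℕ)
    (f : V →ₗ[K] (Fin d → K)) (h : ∀ v (x : Fin d), (x : ℕ) < c → f v x = 0) : rk f ≤ d - c := by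
  let R : (Fin d → K) →ₗ[K] (Fin (d - c) → K) :=
    LinearMap.funLeft K K fun j => ⟨c + j, by omega⟩
  have hR : Function.Injective (R.domRestrict (LinearMap.range f)) := by
    rw [← LinearMap.ker_eq_bot, LinearMap.ker_eq_bot']
    rintro ⟨_, v, rfl⟩ hv
    ext x
    by_cases hx : (x : ℕ) < c
    · exact h v x hx
    · have := congrFun hv ⟨x - c, by omega⟩
      simpa [R, LinearMap.funLeft_apply, Nat.add_sub_cancel' (not_lt.1 hx)] using this
  have := LinearMap.finrank_le_finrank_of_injective hR
  rwa [Module.finrank_fin_fun] at this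

/-- Placing the vectors of a tuple one after the other, filling up with zeros. -/
def blockIncl (K : Type*) [Field K] (s d : ℕ) :
    (Fin (d / 2 ^ s) → Fin (2 ^ s) → K) →ₗ[K] (Fin d → K) where
  toFun w x := if h : (x : ℕ) / 2 ^ s < d / 2 ^ s then
    w ⟨x / 2 ^ s, h⟩ ⟨x % 2 ^ s, Nat.mod_lt _ (by positivity)⟩ else 0
  map_add' v w := by
    ext x
    by_cases h : (x : ℕ) / 2 ^ s < d / 2 ^ s <;> simp [h]
  map_smul' c v := by
    ext x
    by_cases h : (x : ℕ) / 2 ^ s < d / 2 ^ s <;> simp [h]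

theorem block_lt {N d b a : ℕ} (hb : b < d / N) (ha : a < N) : b * N + a < d := by
  calc b * N + a < (b + 1) * N := by rw [add_mul, one_mul]; omega
    _ ≤ d / N * N := Nat.mul_le_mul_right _ hb
    _ ≤ d := Nat.div_mul_le_self _ _

/-- Cutting a vector into consecutive blocks, leaving out the remainder. -/
def blockProj (K : Type*) [Field K] (s d : ℕ) :
    (Fin d → K) →ₗ[K] (Fin (d / 2 ^ s) → Fin (2 ^ s) → K) where
  toFun v b a := v ⟨b * 2 ^ s + a, block_lt b.2 a.2⟩
  map_add' _ _ := rfl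
  map_smul' _ _ := rfl

theorem blockProj_blockIncl (s d : ℕ) (w : Fin (d / 2 ^ s) → Fin (2 ^ s) → K) :
    blockProj K s d (blockIncl K s d w) = w := by
  funext b a
  have h1 : ((b : ℕ) * 2 ^ s + a) / 2 ^ s = b := by
    rw [mul_comm, Nat.mul_add_div (by positivity), Nat.div_eq_of_lt a.2, add_zero]
  have h2 : ((b : ℕ) * 2 ^ s + a) % 2 ^ s = a := by
    rw [mul_comm, Nat.mul_add_mod, Nat.mod_eq_of_lt a.2]
  simp [blockProj, blockIncl, h1, h2]

theorem blockIncl_injective (s d : ℕ) : Function.Injective (blockIncl K s d) :=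
  Function.LeftInverse.injective (blockProj_blockIncl s d)

/-- The block diagonal endomorphism of `K ^ d` with as many diagonal blocks `A` as fit, and zero on
the remaining coordinates. -/
def inflate {s : ℕ} (d : ℕ) (A : Dyadic K s) : Module.End K (Fin d → K) :=
  blockIncl K s d ∘ₗ LinearMap.piMap (fun _ => Matrix.toLin' A) ∘ₗ blockProj K s d

theorem inflate_add {s : ℕ} (d : ℕ) (A B : Dyadic K s) :
    inflate d (A + B) = inflate d A + inflate d B := by
  rw [inflate, inflate, inflate, ← LinearMap.comp_add, ← LinearMap.add_comp]
  congr 2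
  refine LinearMap.ext fun v => funext fun b => ?_
  simp

theorem inflate_smul {s : ℕ} (d : ℕ) (c : K) (A : Dyadic K s) :
    inflate d (c • A) = c • inflate d A := by
  rw [inflate, inflate, ← LinearMap.comp_smul, ← LinearMap.smul_comp]
  congr 2
  refine LinearMap.ext fun v => funext fun b => ?_
  simp

theorem inflate_mul {s : ℕ} (d : ℕ) (A B : Dyadic K s) :
    inflate d (A * B) = inflate d A * inflate d B := by
  refine LinearMap.ext fun v => ?_
  simp only [inflate, LinearMap.comp_apply, Module.End.mul_apply, blockProj_blockIncl]
  congr 1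
  funext b
  simp

theorem inflate_sub {s : ℕ} (d : ℕ) (A B : Dyadic K s) :
    inflate d (A - B) = inflate d A - inflate d B := by
  rw [eq_sub_iff_add_eq, ← inflate_add, sub_add_cancel]

theorem inflate_apply {s : ℕ} (d : ℕ) (A : Dyadic K s) (v : Fin d → K) (x : Fin d)
    (h : (x : ℕ) / 2 ^ s < d / 2 ^ s) : inflate d A v x =
      ∑ y : Fin (2 ^ s), A ⟨x % 2 ^ s, Nat.mod_lt _ (by positivity)⟩ y *
        v ⟨x / 2 ^ s * 2 ^ s + y, block_lt h y.2⟩ := by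
  simp [inflate, blockIncl, h, Matrix.mulVec, dotProduct, blockProj]

theorem div_lt_div_of_lt_mul {x N d : ℕ} (hN : 0 < N) (h : x < d / N * N) : x / N < d / N :=
  (Nat.div_lt_iff_lt_mul hN).2 h

theorem sub_div_mul_le (d : ℕ) {N : ℕ} (hN : 0 < N) : d - d / N * N ≤ N := by
  have := Nat.lt_div_mul_add (a := d) hN
  omega

theorem rk_inflate_one_sub_one_le (s d : ℕ) :
    rk (inflate d (1 : Dyadic K s) - 1) ≤ 2 ^ s := by
  refine (rk_le_of_forall_lt (d / 2 ^ s * 2 ^ s) _ fun v x hx => ?_).trans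
    (sub_div_mul_le d (by positivity))
  have h := div_lt_div_of_lt_mul (by positivity) hx
  rw [LinearMap.sub_apply, Pi.sub_apply, inflate_apply d _ v x h]
  simp only [Matrix.one_apply, ite_mul, one_mul, zero_mul, Finset.sum_ite_eq, Finset.mem_univ,
    if_true, Module.End.one_apply]
  simp [Nat.div_add_mod']

/-- Inflation is compatible with the diagonal embeddings, up to small rank. -/
theorem rk_inflate_diagEmb_sub_le {s s' : ℕ} (h : s ≤ s') (d : ℕ) (A : Dyadic K s) :
    rk (inflate d (diagEmb K h A) - inflate d A) ≤ 2 ^ s' := by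
  refine (rk_le_of_forall_lt (d / 2 ^ s' * 2 ^ s') _ fun v x hx => ?_).trans
    (sub_div_mul_le d (by positivity))
  have h1 := div_lt_div_of_lt_mul (by positivity) hx
  have h2 : (x : ℕ) / 2 ^ s < d / 2 ^ s := by
    refine div_lt_div_of_lt_mul (by positivity) (hx.trans_le ?_)
    obtain ⟨c, rfl⟩ := Nat.exists_eq_add_of_le h
    rw [pow_add, mul_comm (2 ^ s), ← mul_assoc]
    refine Nat.mul_le_mul_right _ ((Nat.le_div_iff_mul_le (by positivity)).2 ?_)
    rw [mul_assoc]
    exact Nat.div_mul_le_self _ _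
  rw [LinearMap.sub_apply, Pi.sub_apply, inflate_apply d _ v x h1, inflate_apply d _ v x h2,
    sub_eq_zero, ← (blockEquiv h).sum_comp, Fintype.sum_prod_type]
  refine Finset.sum_congr rfl fun a _ => ?_
  have hN : (0 : ℕ) < 2 ^ s := by positivity
  have hval : ∀ b, ((blockEquiv h (a, b) : Fin (2 ^ s')) : ℕ) = 2 ^ s * b + a := fun b => by
    simp [blockEquiv, add_comm]
  have hdvd : 2 ^ s' = 2 ^ s * 2 ^ (s' - s) := by rw [← pow_add, Nat.add_sub_cancel' h]
  have hlt : (x : ℕ) % 2 ^ s' / 2 ^ s < 2 ^ (s' - s) := by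
    rw [Nat.div_lt_iff_lt_mul hN, mul_comm, ← hdvd]
    exact Nat.mod_lt _ (by positivity)
  rw [Finset.sum_eq_single ⟨(x : ℕ) % 2 ^ s' / 2 ^ s, hlt⟩]
  · have hpos : (x : ℕ) / 2 ^ s' * 2 ^ s' + (2 ^ s * ((x : ℕ) % 2 ^ s' / 2 ^ s) + a) =
        x / 2 ^ s * 2 ^ s + a := by
      have h3 : (x : ℕ) / 2 ^ s = 2 ^ (s' - s) * (x / 2 ^ s') + x % 2 ^ s' / 2 ^ s := by
        conv_lhs => rw [← Nat.div_add_mod (x : ℕ) (2 ^ s')]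
        nth_rw 1 [hdvd]
        rw [mul_assoc, Nat.mul_add_div hN]
      rw [h3]
      nth_rw 2 [hdvd]
      ring
    rw [diagEmb_apply]
    simp only [hval, Nat.mul_add_div hN, Nat.div_eq_of_lt a.2, add_zero, if_true,
      Nat.mul_add_mod, Nat.mod_eq_of_lt a.2, Nat.mod_mod_of_dvd _ (pow_dvd_pow 2 h), hpos]
  · intro b _ hb
    rw [diagEmb_apply]
    simp only [hval, Nat.mul_add_div hN, Nat.div_eq_of_lt a.2, add_zero]
    rw [if_neg, zero_mul]
    exact fun h' => hb (Fin.ext h'.symm)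
  · simp

/-- The rank of a matrix of inflations: each diagonal block contributes the rank of the matrix that
is inflated. -/
theorem rk_inflate {s : ℕ} {k l : ℕ} (d : ℕ) (A : Matrix (Fin k) (Fin l) (Dyadic K s)) :
    (rk (matAct (A.map (inflate d))) : ℝ) = (d / 2 ^ s : ℕ) * (matRank A * 2 ^ s) := by
  rw [← rk_matAct_toLin']
  set B := A.map fun B => (Matrix.toLin' B : Module.End K (Fin (2 ^ s) → K)) with hB
  set q := d / 2 ^ s with hq
  let I : (Fin k → Fin q → Fin (2 ^ s) → K) →ₗ[K] (Fin k → Fin d → K) :=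
    LinearMap.piMap fun _ => blockIncl K s d
  let P : (Fin l → Fin d → K) →ₗ[K] (Fin l → Fin q → Fin (2 ^ s) → K) :=
    LinearMap.piMap fun _ => blockProj K s d
  let sw : ∀ n : ℕ, (Fin n → Fin q → Fin (2 ^ s) → K) ≃ₗ[K] (Fin q → Fin n → Fin (2 ^ s) → K) :=
    fun n =>
    { toFun := fun v b a => v a b
      invFun := fun v a b => v b a
      map_add' := fun _ _ => rfl
      map_smul' := fun _ _ => rfl
      left_inv := fun _ => rfl
      right_inv := fun _ => rfl }
  have h : matAct (A.map (inflate d)) = I ∘ₗ (sw k).symm.toLinearMap ∘ₗ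
      (matAct B).compLeft (Fin q) ∘ₗ (sw l).toLinearMap ∘ₗ P := by
    refine LinearMap.ext fun v => funext fun i => ?_
    rw [matAct_apply]
    simp only [Matrix.map_apply, inflate, LinearMap.comp_apply]
    rw [← map_sum]
    change blockIncl K s d _ = blockIncl K s d _
    congr 1
    funext b
    rw [Finset.sum_apply]
    change _ = matAct B (fun j => blockProj K s d (v j) b) i
    rw [matAct_apply]
    rfl
  have hI : Function.Injective I := fun v w hvw => funext fun i =>
    blockIncl_injective s d (congrFun hvw i)
  have hP : Function.Surjective P := fun w =>
    ⟨fun i => blockIncl K s d (w i), funext fun i => blockProj_blockIncl s d (w i)⟩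
  rw [h, rk_comp_of_injective hI, rk_comp_of_injective (sw k).symm.injective, ← LinearMap.comp_assoc,
    rk_comp_of_surjective _ hP, rk_comp_of_surjective _ (sw l).surjective, rk,
    finrank_range_compLeft, Fintype.card_fin]
  push_cast
  rfl

theorem rk_inflate_single {s : ℕ} (d : ℕ) (A : Dyadic K s) :
    (rk (inflate d A) : ℝ) = (d / 2 ^ s : ℕ) * A.rank := by
  have h := rk_inflate d (Matrix.of fun _ _ : Fin 1 => A)
  rw [matRank_single, div_mul_cancel₀ _ (by positivity)] at h
  rw [← h, ← rk_matAct_single]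
  rfl

/-- Inflations are near to direct sums of copies. -/
theorem near_inflate {ι : Type*} {s : ℕ} (T : ι → Dyadic K s) (d : ℕ) :
    Near (copies (d / 2 ^ s) (dyadicSystem T)) (fun i => inflate d (T i)) (2 ^ s) := by
  refine (near_of_injective (blockIncl K s d) (blockIncl_injective s d) fun i v => ?_).mono ?_
  · simp only [inflate, LinearMap.comp_apply, blockProj_blockIncl]
    rfl
  · rw [Module.finrank_fin_fun, finrank_tuple, Module.finrank_fin_fun]
    have := sub_le_cast_div_mul d (b := 2 ^ s) (by positivity)
    push_cast at this ⊢
    linarith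

end inflate

/-! ### The rank metric of the continuous ultraproduct -/

/-- Countably many properties, each of which holds almost everywhere, hold along a sequence of
indices that tends to infinity. -/
theorem exists_tendsto_atTop_eventually {ω : Ultrafilter ℕ} (hω : (ω : Filter ℕ) ≤ cofinite)
    {P : ℕ → ℕ → Prop} (h : ∀ m, ∀ᶠ n in ω, P m n) :
    ∃ j : ℕ → ℕ, Tendsto j ω atTop ∧ ∀ᶠ n in ω, P (j n) n := by
  classical
  have hat : (ω : Filter ℕ) ≤ atTop := by rwa [← Nat.cofinite_eq_atTop]
  refine ⟨fun n => Nat.findGreatest (fun m => P m n) n, tendsto_atTop.2 fun b => ?_, ?_⟩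
  · filter_upwards [h b, hat (eventually_ge_atTop b)] with n h1 h2
    exact Nat.le_findGreatest h2 h1
  · filter_upwards [h 0] with n h1
    exact Nat.findGreatest_spec (P := fun m => P m n) (Nat.zero_le n) h1

section ultraproduct

variable {K : Type*} [Field K] {V : ℕ → Type*} [∀ n, AddCommGroup (V n)]
  [∀ n, Module K (V n)] [∀ n, Module.Finite K (V n)] {ω : Ultrafilter ℕ}

variable (ω) in
/-- The class of a sequence of endomorphisms in the continuous ultraproduct. -/
def ultraMk : (∀ n, Module.End K (V n)) →ₐ[K] ContUltraproduct K V ω :=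
  Ideal.Quotient.mkₐ K (rankIdeal K V ω)

theorem ultraMk_surjective : Function.Surjective (ultraMk (K := K) (V := V) ω) :=
  Ideal.Quotient.mk_surjective

theorem ultraMk_eq_zero_iff {a : ∀ n, Module.End K (V n)} :
    ultraMk ω a = 0 ↔ Tendsto (fun n => endRank (a n)) ω (𝓝 0) :=
  Ideal.Quotient.eq_zero_iff_mem

/-- The rank over the ultraproduct is the ultralimit of the ranks of any representatives. -/
theorem tendsto_endMatRank {k l : ℕ} (a : Matrix (Fin k) (Fin l) (∀ n, Module.End K (V n))) :
    Tendsto (fun n => endMatRank (a.map fun x => x n)) ω (𝓝 (ultraRank (a.map (ultraMk ω)))) := by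
  set b : Matrix (Fin k) (Fin l) (∀ n, Module.End K (V n)) :=
    (a.map (ultraMk ω)).map (Function.surjInv Ideal.Quotient.mk_surjective) with hb
  have h1 : ∀ i j, Tendsto (fun n => endRank (a i j n - b i j n)) ω (𝓝 0) := by
    intro i j
    have h2 : ultraMk ω (b i j) = ultraMk ω (a i j) :=
      Function.surjInv_eq Ideal.Quotient.mk_surjective _
    refine ultraMk_eq_zero_iff.1 (?_ : ultraMk ω (a i j - b i j) = 0)
    rw [map_sub, h2, sub_self]
  have h2 : Tendsto (fun n => endMatRank (b.map fun x => x n)) ω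
      (𝓝 (ultraRank (a.map (ultraMk ω)))) := by
    refine tendsto_nhds_limUnder ?_
    exact exists_tendsto_of_mem_Icc ω fun n => ⟨endMatRank_nonneg _, endMatRank_le _⟩
  have h3 : Tendsto (fun n => endMatRank (a.map fun x => x n) -
      endMatRank (b.map fun x => x n)) ω (𝓝 0) := by
    have h4 : Tendsto (fun n => ∑ i, ∑ j, endRank (a i j n - b i j n)) ω (𝓝 0) := by
      simpa using tendsto_finsetSum Finset.univ fun i _ =>
        tendsto_finsetSum Finset.univ fun j _ => h1 i j
    exact squeeze_zero_norm (fun n => abs_endMatRank_sub_le _ _) h4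
  simpa using h3.add h2

theorem exists_map_ultraMk {k l : ℕ} (A : Matrix (Fin k) (Fin l) (ContUltraproduct K V ω)) :
    ∃ a : Matrix (Fin k) (Fin l) (∀ n, Module.End K (V n)), a.map (ultraMk ω) = A := by
  choose a ha using fun i j => ultraMk_surjective (A i j)
  exact ⟨Matrix.of a, by ext i j; exact ha i j⟩

/-- The rank of an element of the continuous ultraproduct. -/
def ultraNorm (u : ContUltraproduct K V ω) : ℝ :=
  ultraRank (Matrix.of fun _ _ : Fin 1 => u)

theorem tendsto_endRank (a : ∀ n, Module.End K (V n)) :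
    Tendsto (fun n => endRank (a n)) ω (𝓝 (ultraNorm (ultraMk ω a))) := by
  have h := tendsto_endMatRank (ω := ω) (Matrix.of fun _ _ : Fin 1 => a)
  have h1 : ∀ n, endMatRank ((Matrix.of fun _ _ : Fin 1 => a).map fun x => x n) =
      endRank (a n) := fun n => by
    rw [endMatRank_eq, endRank_eq, ← rk_matAct_single (a n)]
    rfl
  simp only [h1] at h
  exact h

theorem ultraNorm_mul_le_left (u v : ContUltraproduct K V ω) :
    ultraNorm (u * v) ≤ ultraNorm u := by
  obtain ⟨a, rfl⟩ := ultraMk_surjective u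
  obtain ⟨b, rfl⟩ := ultraMk_surjective v
  rw [← map_mul]
  exact le_of_tendsto_of_tendsto' (tendsto_endRank _) (tendsto_endRank _) fun n =>
    endRank_mul_le_left _ _

theorem ultraNorm_mul_le_right (u v : ContUltraproduct K V ω) :
    ultraNorm (u * v) ≤ ultraNorm v := by
  obtain ⟨a, rfl⟩ := ultraMk_surjective u
  obtain ⟨b, rfl⟩ := ultraMk_surjective v
  rw [← map_mul]
  exact le_of_tendsto_of_tendsto' (tendsto_endRank _) (tendsto_endRank _) fun n =>
    endRank_mul_le_right _ _

theorem ultraNorm_add_le (u v : ContUltraproduct K V ω) :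
    ultraNorm (u + v) ≤ ultraNorm u + ultraNorm v := by
  obtain ⟨a, rfl⟩ := ultraMk_surjective u
  obtain ⟨b, rfl⟩ := ultraMk_surjective v
  rw [← map_add]
  exact le_of_tendsto_of_tendsto' (tendsto_endRank _)
    ((tendsto_endRank _).add (tendsto_endRank _)) fun n => endRank_add_le _ _

theorem ultraNorm_neg (u : ContUltraproduct K V ω) : ultraNorm (-u) = ultraNorm u := by
  obtain ⟨a, rfl⟩ := ultraMk_surjective u
  rw [← map_neg]
  refine tendsto_nhds_unique (tendsto_endRank _) ((tendsto_endRank a).congr fun n => ?_)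
  rw [endRank_eq, endRank_eq, Pi.neg_apply, rk_neg]

theorem ultraNorm_eq_zero_iff {u : ContUltraproduct K V ω} : ultraNorm u = 0 ↔ u = 0 := by
  obtain ⟨a, rfl⟩ := ultraMk_surjective u
  rw [ultraMk_eq_zero_iff]
  refine ⟨fun h => h ▸ tendsto_endRank a, fun h => tendsto_nhds_unique (tendsto_endRank a) h⟩

/-- The rank metric `d(u, v) = rank(u - v)`. -/
instance : MetricSpace (ContUltraproduct K V ω) where
  dist u v := ultraNorm (u - v)
  dist_self u := by rw [sub_self, ultraNorm_eq_zero_iff.2 rfl]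
  dist_comm u v := by rw [← neg_sub, ultraNorm_neg]
  dist_triangle u v w := by
    rw [← sub_add_sub_cancel u v w]
    exact ultraNorm_add_le _ _
  eq_of_dist_eq_zero {u v} h := sub_eq_zero.1 (ultraNorm_eq_zero_iff.1 h)

theorem ultra_dist_def (u v : ContUltraproduct K V ω) : dist u v = ultraNorm (u - v) := rfl

theorem tendsto_endRank_sub (a b : ∀ n, Module.End K (V n)) :
    Tendsto (fun n => endRank (a n - b n)) ω (𝓝 (dist (ultraMk ω a) (ultraMk ω b))) := by
  rw [ultra_dist_def, ← map_sub]
  exact tendsto_endRank (a - b)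

instance : IsUniformAddGroup (ContUltraproduct K V ω) where
  uniformContinuous_sub := by
    rw [Metric.uniformContinuous_iff]
    intro ε hε
    refine ⟨ε / 2, half_pos hε, fun {p q} h => ?_⟩
    rw [Prod.dist_eq, max_lt_iff, ultra_dist_def, ultra_dist_def] at h
    rw [ultra_dist_def, show p.1 - p.2 - (q.1 - q.2) = (p.1 - q.1) + -(p.2 - q.2) by abel]
    have := ultraNorm_add_le (p.1 - q.1) (-(p.2 - q.2))
    rw [ultraNorm_neg] at this
    linarith

instance : IsTopologicalRing (ContUltraproduct K V ω) where
  continuous_mul := by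
    refine UniformContinuous.continuous ?_
    rw [Metric.uniformContinuous_iff]
    intro ε hε
    refine ⟨ε / 2, half_pos hε, fun {p q} h => ?_⟩
    rw [Prod.dist_eq, max_lt_iff, ultra_dist_def, ultra_dist_def] at h
    rw [ultra_dist_def,
      show p.1 * p.2 - q.1 * q.2 = (p.1 - q.1) * p.2 + q.1 * (p.2 - q.2) by noncomm_ring]
    have h1 := ultraNorm_add_le ((p.1 - q.1) * p.2) (q.1 * (p.2 - q.2))
    have h2 := ultraNorm_mul_le_left (p.1 - q.1) p.2
    have h3 := ultraNorm_mul_le_right q.1 (p.2 - q.2)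
    linarith

/-- The continuous ultraproduct is complete, by a diagonal argument. -/
theorem completeSpace_contUltraproduct (hω : (ω : Filter ℕ) ≤ cofinite) :
    CompleteSpace (ContUltraproduct K V ω) := by
  refine Metric.complete_of_convergent_controlled_sequences (fun N => (1 / 2) ^ N)
    (fun N => by positivity) fun u hu => ?_
  choose a ha using fun j => ultraMk_surjective (u j)
  have hP : ∀ m, ∀ᶠ n in ω, ∀ i ∈ Finset.range (m + 1),
      endRank (a i n - a m n) < (1 / 2) ^ i := by
    intro m
    refine (Finset.eventually_all _).2 fun i hi => ?_
    have h := tendsto_endRank_sub (ω := ω) (a i) (a m)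
    rw [ha, ha] at h
    exact h.eventually_lt_const (hu i i m le_rfl (Nat.lt_succ_iff.1 (Finset.mem_range.1 hi)))
  obtain ⟨j, hj, hjP⟩ := exists_tendsto_atTop_eventually hω hP
  refine ⟨ultraMk ω fun n => a (j n) n, tendsto_iff_dist_tendsto_zero.2 ?_⟩
  refine squeeze_zero (fun _ => dist_nonneg) (fun i => ?_)
    (tendsto_pow_atTop_nhds_zero_of_lt_one (r := (1 / 2 : ℝ)) (by norm_num) (by norm_num))
  rw [← ha i]
  refine le_of_tendsto (tendsto_endRank_sub _ _) ?_
  filter_upwards [hjP, hj.eventually_ge_atTop i] with n h1 h2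
  exact (h1 i (Finset.mem_range.2 (Nat.lt_succ_of_le h2))).le

/-- The rank of matrices over the continuous ultraproduct is continuous. -/
theorem continuous_ultraRank {k l : ℕ} :
    Continuous (ultraRank : Matrix (Fin k) (Fin l) (ContUltraproduct K V ω) → ℝ) := by
  have h : ∀ A B : Matrix (Fin k) (Fin l) (ContUltraproduct K V ω),
      |ultraRank A - ultraRank B| ≤ ∑ i, ∑ j, dist (A i j) (B i j) := by
    intro A B
    obtain ⟨a, rfl⟩ := exists_map_ultraMk A
    obtain ⟨b, rfl⟩ := exists_map_ultraMk B
    exact le_of_tendsto_of_tendsto' ((tendsto_endMatRank a).sub (tendsto_endMatRank b)).abs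
      (tendsto_finsetSum _ fun i _ => tendsto_finsetSum _ fun j _ =>
        tendsto_endRank_sub (a i j) (b i j)) fun n => abs_endMatRank_sub_le _ _
  rw [continuous_iff_continuousAt]
  intro A
  rw [ContinuousAt, tendsto_iff_dist_tendsto_zero]
  refine squeeze_zero (fun _ => dist_nonneg) (fun B => h B A) ?_
  have hc : Continuous fun B : Matrix (Fin k) (Fin l) (ContUltraproduct K V ω) =>
      ∑ i, ∑ j, dist (B i j) (A i j) := by fun_prop
  simpa using hc.tendsto A

end ultraproduct

/-! ### Coordinates in which the modules are nearly inflated dyadic matrices -/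

section coordinates

variable {K ι : Type*} [Field K] {V : ℕ → Type*} [∀ n, AddCommGroup (V n)]
  [∀ n, Module K (V n)] [∀ n, Module.Finite K (V n)]

theorem dist_le_of_geometric {α : Type*} [PseudoMetricSpace α] {f : ℕ → α} {C : ℝ}
    (h : ∀ m, dist (f m) (f (m + 1)) ≤ C / 2 * (1 / 2) ^ m) {m j : ℕ} (hmj : m ≤ j) (hC : 0 ≤ C) :
    dist (f m) (f j) ≤ C * (1 / 2) ^ m := by
  have key : dist (f m) (f j) ≤ C * (1 / 2) ^ m - C * (1 / 2) ^ j := by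
    induction j, hmj using Nat.le_induction with
    | base => simp
    | succ j _ ih =>
      refine (dist_triangle _ (f j) _).trans ((add_le_add ih (h j)).trans (le_of_eq ?_))
      ring
  exact key.trans (sub_le_self _ (by positivity))

/-- Inflations of dyadic matrices that are close in the direct limit are close in rank. -/
theorem rk_inflate_sub_le {s s' : ℕ} (h : s ≤ s') (d : ℕ) (A : Dyadic K s) (B : Dyadic K s') :
    (rk (inflate d A - inflate d B) : ℝ) ≤
      2 ^ s' + dist (level K s A) (level K s' B) * d := by
  have h1 : (rk (inflate d A - inflate d B) : ℝ) ≤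
      rk (inflate d (diagEmb K h A) - inflate d A) + rk (inflate d (diagEmb K h A - B)) := by
    rw [inflate_sub, rk_sub_comm (inflate d (diagEmb K h A)) (inflate d A)]
    exact_mod_cast rk_sub_le_add _ _ _
  have h2 : (rk (inflate d (diagEmb K h A) - inflate d A) : ℝ) ≤ 2 ^ s' := by
    exact_mod_cast rk_inflate_diagEmb_sub_le h d A
  rw [rk_inflate_single] at h1
  rw [← level_diagEmb h, dist_level]
  have h3 := cast_div_mul_le d (2 ^ s')
  have h4 : ((d / 2 ^ s' : ℕ) : ℝ) * (diagEmb K h A - B).rank ≤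
      (diagEmb K h A - B).rank / 2 ^ s' * d := by
    rw [div_mul_eq_mul_div, le_div_iff₀ (by positivity)]
    push_cast at h3
    calc ((d / 2 ^ s' : ℕ) : ℝ) * (diagEmb K h A - B).rank * 2 ^ s' =
        (diagEmb K h A - B).rank * ((d / 2 ^ s' : ℕ) * 2 ^ s') := by ring
      _ ≤ _ := by gcongr
  linarith

/-- For a hyperfinite sequence there are coordinates on the spaces `V n` such that each of the
endomorphisms is approximated, along the ultrafilter, by inflations of fixed dyadic matrices. -/
theorem NearHyperfinite.exists_coordinates {ω : Ultrafilter ℕ} {φ : ∀ n, ι → Module.End K (V n)}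
    (h : NearHyperfinite φ) (hω : (ω : Filter ℕ) ≤ cofinite)
    (hd : Tendsto (fun n => Module.finrank K (V n)) ω atTop) :
    ∃ e : ∀ n, (Fin (Module.finrank K (V n)) → K) ≃ₗ[K] V n, ∀ i, ∀ ε : ℝ, 0 < ε →
      ∃ (s : ℕ) (A : Dyadic K s), ∀ᶠ n in ω,
        endRank ((e n).conj (inflate (Module.finrank K (V n)) A) - φ n i) ≤ ε := by
  obtain ⟨s, T, hs, hT, hdist⟩ := h.exists_models hd
  have hdR : Tendsto (fun n => (Module.finrank K (V n) : ℝ)) ω atTop :=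
    tendsto_natCast_atTop_atTop.comp hd
  let P : ℕ → ℕ → Prop := fun m n =>
    Near (copies (Module.finrank K (V n) / 2 ^ s m) (dyadicSystem (T m))) (φ n)
      ((1 / 2) ^ m * Module.finrank K (V n)) ∧
    (2 : ℝ) ^ s m ≤ (1 / 2) ^ m * Module.finrank K (V n) ∧ 0 < Module.finrank K (V n)
  have hP : ∀ m, ∀ᶠ n in ω, P m n := by
    intro m
    have hpos : (0 : ℝ) < (1 / 2) ^ m := by positivity
    filter_upwards [hT m, hdR.eventually_ge_atTop (2 ^ s m / (1 / 2) ^ m),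
      hd.eventually_gt_atTop 0] with n h1 h2 h3
    exact ⟨h1, (div_le_iff₀' hpos).1 h2, h3⟩
  obtain ⟨j, hj, hjP⟩ := exists_tendsto_atTop_eventually hω hP
  have he : ∀ n, ∃ e : (Fin (Module.finrank K (V n)) → K) ≃ₗ[K] V n, P (j n) n → ∀ i,
      (rk (e.conj (inflate (Module.finrank K (V n)) (T (j n) i)) - φ n i) : ℝ) ≤
        12 * (1 / 2) ^ j n * Module.finrank K (V n) := by
    intro n
    by_cases hn : P (j n) n
    · have h1 := (near_inflate (T (j n)) (Module.finrank K (V n))).symm.trans hn.1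
      obtain ⟨e, he⟩ := h1.exists_equiv (Module.finrank_fin_fun K)
      refine ⟨e, fun _ i => (he i).trans ?_⟩
      linarith [hn.2.1]
    · exact ⟨(Module.finBasis K (V n)).equivFun.symm, fun h => absurd h hn⟩
  choose e he using he
  refine ⟨e, fun i ε hε => ?_⟩
  -- the errors are `1` and `12` times `(1 / 2) ^ j n` for the inflation and the coordinates, and
  -- `9 * (1 / 2) ^ m` for the passage between the models, `22 * (1 / 2) ^ m` in total
  obtain ⟨m, hm⟩ := exists_pow_lt_of_lt_one (show 0 < ε / 22 by positivity)
    (show (1 / 2 : ℝ) < 1 by norm_num)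
  refine ⟨s m, T m i, ?_⟩
  filter_upwards [hjP, hj.eventually_ge_atTop m] with n hn hmn
  set D := Module.finrank K (V n)
  have hD : (0 : ℝ) < D := by exact_mod_cast hn.2.2
  rw [endRank_eq, div_le_iff₀ hD]
  have h1 : (rk ((e n).conj (inflate D (T m i)) - φ n i) : ℝ) ≤
      rk (inflate D (T m i) - inflate D (T (j n) i)) +
      rk ((e n).conj (inflate D (T (j n) i)) - φ n i) := by
    rw [← rk_conj (e n) (inflate D (T m i) - _), map_sub]
    exact_mod_cast rk_sub_le_add _ _ _
  have h2 := rk_inflate_sub_le (hs hmn) D (T m i) (T (j n) i)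
  have h3 : dist (level K (s m) (T m i)) (level K (s (j n)) (T (j n) i)) ≤ 9 * (1 / 2) ^ m :=
    dist_le_of_geometric (f := fun m => level K (s m) (T m i)) (fun m => hdist m i) hmn
      (by norm_num)
  have h4 := he n hn i
  have h5 : ((1 : ℝ) / 2) ^ j n ≤ (1 / 2) ^ m :=
    pow_le_pow_of_le_one (by norm_num) (by norm_num) hmn
  have h6 : (1 / 2 : ℝ) ^ j n * D ≤ (1 / 2) ^ m * D := by gcongr
  have h7 : dist (level K (s m) (T m i)) (level K (s (j n)) (T (j n) i)) * D ≤
      9 * (1 / 2) ^ m * D := by gcongr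
  have h8 : (1 / 2 : ℝ) ^ m * D ≤ ε / 22 * D := by gcongr
  linarith [hn.2.1]

end coordinates

/-! ### The embedding of von Neumann's algebra into the ultraproduct -/

section embedding

variable {K : Type*} [Field K] {V : ℕ → Type*} [∀ n, AddCommGroup (V n)]
  [∀ n, Module K (V n)] [∀ n, Module.Finite K (V n)] {ω : Ultrafilter ℕ}

theorem tendsto_const_div_natCast {α : Type*} {l : Filter α} {D : α → ℕ} (hd : Tendsto D l atTop)
    (c : ℝ) : Tendsto (fun n => c / (D n : ℝ)) l (𝓝 0) :=
  (tendsto_natCast_atTop_atTop.comp hd).const_div_atTop c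

theorem ultraMk_eq_of_rk_sub_le (hd : Tendsto (fun n => Module.finrank K (V n)) ω atTop)
    {a b : ∀ n, Module.End K (V n)} (c : ℕ) (h : ∀ n, rk (a n - b n) ≤ c) :
    ultraMk ω a = ultraMk ω b := by
  rw [← sub_eq_zero, ← map_sub, ultraMk_eq_zero_iff]
  refine squeeze_zero (fun _ => endRank_nonneg _) (fun n => ?_)
    (tendsto_const_div_natCast hd (c : ℝ))
  rw [endRank_eq]
  gcongr
  exact h n

/-- The embedding of the dyadic matrices of a given size into the ultraproduct by inflation, with
respect to given coordinates. It is unital since the dimensions tend to infinity. -/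
def inflateHom (hd : Tendsto (fun n => Module.finrank K (V n)) ω atTop)
    (e : ∀ n, (Fin (Module.finrank K (V n)) → K) ≃ₗ[K] V n) (s : ℕ) :
    Dyadic K s →ₐ[K] ContUltraproduct K V ω :=
  AlgHom.ofLinearMap
    { toFun := fun A => ultraMk ω fun n => (e n).conj (inflate (Module.finrank K (V n)) A)
      map_add' := fun A B => by
        rw [← map_add]
        congr 1
        funext n
        rw [inflate_add, map_add]
        rfl
      map_smul' := fun c A => by
        rw [RingHom.id_apply, ← map_smul]
        congr 1
        funext n
        rw [inflate_smul, map_smul]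
        rfl }
    (by
      refine (ultraMk_eq_of_rk_sub_le (b := 1) hd (2 ^ s) fun n => ?_).trans (map_one _)
      have h1 : (1 : Module.End K (V n)) = (e n).conj 1 := (e n).conj_id.symm
      rw [Pi.one_apply, h1, ← map_sub, rk_conj]
      exact rk_inflate_one_sub_one_le _ _)
    (fun A B => by
      change ultraMk ω _ = ultraMk ω _ * ultraMk ω _
      rw [← map_mul]
      congr 1
      funext n
      rw [inflate_mul]
      exact LinearEquiv.conj_comp (e n) _ _)

theorem inflateHom_apply (hd : Tendsto (fun n => Module.finrank K (V n)) ω atTop)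
    (e : ∀ n, (Fin (Module.finrank K (V n)) → K) ≃ₗ[K] V n) {s : ℕ} (A : Dyadic K s) :
    inflateHom hd e s A =
      ultraMk ω fun n => (e n).conj (inflate (Module.finrank K (V n)) A) := rfl

theorem inflateHom_diagEmb (hd : Tendsto (fun n => Module.finrank K (V n)) ω atTop)
    (e : ∀ n, (Fin (Module.finrank K (V n)) → K) ≃ₗ[K] V n) {s s' : ℕ} (h : s ≤ s')
    (A : Dyadic K s) : inflateHom hd e s A = inflateHom hd e s' (diagEmb K h A) := by
  rw [inflateHom_apply, inflateHom_apply]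
  refine ultraMk_eq_of_rk_sub_le hd (2 ^ s') fun n => ?_
  rw [← map_sub, rk_conj, rk_sub_comm]
  exact rk_inflate_diagEmb_sub_le h _ A

theorem exists_level_eq (x : DyadicLimit K) : ∃ (s : ℕ) (A : Dyadic K s), level K s A = x := by
  obtain ⟨s, B, hB⟩ := exists_level (single x)
  exact ⟨s, B 0 0, congrFun (congrFun hB 0) 0⟩

theorem exists_level_eq₂ (x y : DyadicLimit K) :
    ∃ (s : ℕ) (A B : Dyadic K s), level K s A = x ∧ level K s B = y := by
  obtain ⟨s, B, C, hB, hC⟩ := exists_level₂ (single x) (single y)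
  exact ⟨s, B 0 0, C 0 0, congrFun (congrFun hB 0) 0, congrFun (congrFun hC 0) 0⟩

/-- The embedding of the direct limit of the dyadic matrix algebras into the ultraproduct. -/
def dyadicHom (hd : Tendsto (fun n => Module.finrank K (V n)) ω atTop)
    (e : ∀ n, (Fin (Module.finrank K (V n)) → K) ≃ₗ[K] V n) :
    DyadicLimit K →ₐ[K] ContUltraproduct K V ω :=
  let f : DyadicLimit K → ContUltraproduct K V ω :=
    DirectLimit.lift (fun _ _ h => diagEmb K h) (fun s A => inflateHom hd e s A)
      fun _ _ h A => inflateHom_diagEmb hd e h A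
  have hf : ∀ s A, f (level K s A) = inflateHom hd e s A := fun _ _ => rfl
  AlgHom.ofLinearMap
    { toFun := f
      map_add' := fun x y => by
        obtain ⟨s, A, B, rfl, rfl⟩ := exists_level_eq₂ x y
        rw [← map_add, hf, hf, hf, map_add]
      map_smul' := fun c x => by
        obtain ⟨s, A, rfl⟩ := exists_level_eq x
        rw [← map_smul, hf, hf, map_smul, RingHom.id_apply] }
    (by
      change f 1 = 1
      rw [← map_one (level K 0), hf, map_one])
    (fun x y => by
      change f (x * y) = f x * f y
      obtain ⟨s, A, B, rfl, rfl⟩ := exists_level_eq₂ x y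
      rw [← map_mul, hf, hf, hf, map_mul])

/-- The embedding preserves ranks, since the part of the space not covered by the blocks is
negligible. -/
theorem ultraRank_map_dyadicHom (hd : Tendsto (fun n => Module.finrank K (V n)) ω atTop)
    (e : ∀ n, (Fin (Module.finrank K (V n)) → K) ≃ₗ[K] V n) {k l : ℕ}
    (A : Matrix (Fin k) (Fin l) (DyadicLimit K)) :
    ultraRank (A.map (dyadicHom hd e)) = limRank A := by
  obtain ⟨s, A, rfl⟩ := exists_level A
  rw [limRank_map]
  have h1 : (A.map (level K s)).map (dyadicHom hd e) =
      (A.map fun B => fun n => (e n).conj (inflate (Module.finrank K (V n)) B)).map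
        (ultraMk ω) := rfl
  rw [h1]
  refine tendsto_nhds_unique (tendsto_endMatRank _) ?_
  have h2 : ∀ n, endMatRank ((A.map fun B => fun n =>
      (e n).conj (inflate (Module.finrank K (V n)) B)).map fun x => x n) =
      ((Module.finrank K (V n) / 2 ^ s : ℕ) * 2 ^ s / (Module.finrank K (V n) : ℝ)) *
        matRank A := by
    intro n
    have h3 : ((A.map fun B => fun n =>
      (e n).conj (inflate (Module.finrank K (V n)) B)).map fun x => x n) =
        (A.map (inflate (Module.finrank K (V n)))).map (e n).conj := rfl
    rw [h3, endMatRank_eq, rk_matAct_conj, rk_inflate]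
    ring
  simp only [h2]
  have h4 : Tendsto (fun n => ((Module.finrank K (V n) / 2 ^ s : ℕ) * 2 ^ s /
      (Module.finrank K (V n) : ℝ))) ω (𝓝 1) := by
    have h5 : Tendsto (fun n => 1 - 2 ^ s / (Module.finrank K (V n) : ℝ)) ω (𝓝 1) := by
      simpa using (tendsto_const_div_natCast hd ((2 : ℝ) ^ s)).const_sub 1
    refine tendsto_of_tendsto_of_tendsto_of_le_of_le' h5 tendsto_const_nhds ?_ ?_
    · filter_upwards [hd.eventually_gt_atTop 0] with n hn
      have hn' : (0 : ℝ) < Module.finrank K (V n) := by exact_mod_cast hn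
      have h6 := sub_le_cast_div_mul (Module.finrank K (V n)) (b := 2 ^ s) (by positivity)
      push_cast at h6
      rw [le_div_iff₀ hn', sub_mul, div_mul_cancel₀ _ hn'.ne', one_mul]
      exact h6
    · refine Eventually.of_forall fun n => div_le_one_of_le₀ ?_ (by positivity)
      have h6 := cast_div_mul_le (Module.finrank K (V n)) (2 ^ s)
      push_cast at h6
      exact h6
  simpa using h4.mul_const (matRank A)

theorem isometry_dyadicHom (hd : Tendsto (fun n => Module.finrank K (V n)) ω atTop)
    (e : ∀ n, (Fin (Module.finrank K (V n)) → K) ≃ₗ[K] V n) : Isometry (dyadicHom hd e) := by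
  refine Isometry.of_dist_eq fun x y => ?_
  rw [ultra_dist_def, ← map_sub, dist_def, ← ultraRank_map_dyadicHom hd e]
  rfl

/-- For a hyperfinite sequence with dimensions tending to infinity along the ultrafilter, there is
a rank-preserving copy of von Neumann's algebra in the ultraproduct that contains the classes of
the given endomorphisms. -/
theorem NearHyperfinite.exists_vonNeumann_embedding {ι : Type*} {φ : ∀ n, ι → Module.End K (V n)}
    (h : NearHyperfinite φ) (hω : (ω : Filter ℕ) ≤ cofinite)
    (hd : Tendsto (fun n => Module.finrank K (V n)) ω atTop) :
    ∃ Φ : VonNeumann K →ₐ[K] ContUltraproduct K V ω, Function.Injective Φ ∧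
      (∀ i, ultraMk ω (fun n => φ n i) ∈ Φ.range) ∧
      ∀ (k l : ℕ) (A : Matrix (Fin k) (Fin l) (VonNeumann K)),
        ultraRank (A.map Φ) = vnRank A := by
  obtain ⟨e, he⟩ := h.exists_coordinates hω hd
  have := completeSpace_contUltraproduct (K := K) (V := V) hω
  have hiso := isometry_dyadicHom hd e
  let F : VonNeumann K →+* ContUltraproduct K V ω :=
    UniformSpace.Completion.extensionHom (dyadicHom hd e).toRingHom hiso.continuous
  have hF : ∀ x : DyadicLimit K, F x = dyadicHom hd e x := fun x =>
    UniformSpace.Completion.extensionHom_coe _ hiso.continuous x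
  let Φ : VonNeumann K →ₐ[K] ContUltraproduct K V ω :=
    { F with
      commutes' := fun c => (hF (algebraMap K _ c)).trans ((dyadicHom hd e).commutes c) }
  have hΦ : Isometry Φ := hiso.completion_extension
  refine ⟨Φ, hΦ.injective, fun i => ?_, fun k l A => ?_⟩
  · have hcl : IsClosed (Set.range Φ) := hΦ.isClosedEmbedding.isClosed_range
    refine hcl.closure_subset (Metric.mem_closure_iff.2 fun ε hε => ?_)
    obtain ⟨s, A, hA⟩ := he i (ε / 2) (by positivity)
    refine ⟨_, ⟨(level K s A : DyadicLimit K), rfl⟩, ?_⟩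
    have h1 : Φ (level K s A : DyadicLimit K) = ultraMk ω fun n =>
      (e n).conj (inflate (Module.finrank K (V n)) A) := hF _
    rw [h1, dist_comm]
    exact (le_of_tendsto (tendsto_endRank_sub _ _) hA).trans_lt (by linarith)
  · have hc : Continuous fun A : Matrix (Fin k) (Fin l) (VonNeumann K) =>
        ultraRank (A.map Φ) :=
      continuous_ultraRank.comp (continuous_id.matrix_map hΦ.continuous)
    refine (congrFun ((isDenseInducing_map_coe K k l).extend_unique (fun B => ?_) hc) A).symm
    rw [← ultraRank_map_dyadicHom hd e B]
    congr 1
    ext a b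
    exact hF _

end embedding

/-! ### The ultraproduct representation -/

/-- The rank function of a module does not change when the module is repeated. -/
theorem moduleRank_tuple (K : Type*) {R : Type*} (M : Type*) [Field K] [Ring R] [Algebra K R]
    [AddCommGroup M] [Module K M] [Module R M] [IsScalarTower K R M] [Module.Finite K M]
    {q k l : ℕ} (hq : 0 < q) (A : Matrix (Fin k) (Fin l) R) :
    moduleRank K (Fin q → M) A = moduleRank K M A := by
  let sw : ∀ n : ℕ, (Fin n → Fin q → M) ≃ₗ[K] (Fin q → Fin n → M) := fun n =>
    { toFun := fun v b a => v a b
      invFun := fun v a b => v b a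
      map_add' := fun _ _ => rfl
      map_smul' := fun _ _ => rfl
      left_inv := fun _ => rfl
      right_inv := fun _ => rfl }
  have h : matAct (A.map (Algebra.lsmul K K (Fin q → M))) = (sw k).symm.toLinearMap ∘ₗ
      (matAct (A.map (Algebra.lsmul K K M))).compLeft (Fin q) ∘ₗ (sw l).toLinearMap := by
    refine LinearMap.ext fun v => funext fun i => funext fun b => ?_
    rw [matAct_apply, Finset.sum_apply]
    change _ = matAct (A.map (Algebra.lsmul K K M)) (fun j => v j b) i
    rw [matAct_apply]
    rfl
  rw [moduleRank, moduleRank, endMatRank_eq, endMatRank_eq, h,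
    rk_comp_of_injective (sw k).symm.injective, rk_comp_of_surjective _ (sw l).surjective, rk,
    finrank_range_compLeft, Fintype.card_fin, finrank_tuple]
  have : (q : ℝ) ≠ 0 := by positivity
  push_cast
  exact mul_div_mul_left _ _ this

theorem tendsto_moduleRank {K R : Type*} [Field K] [Ring R] [Algebra K R] (M : ℕ → Type*)
    [∀ n, AddCommGroup (M n)] [∀ n, Module K (M n)] [∀ n, Module R (M n)]
    [∀ n, IsScalarTower K R (M n)] [∀ n, Module.Finite K (M n)] (ω : Ultrafilter ℕ) {k l : ℕ}
    (A : Matrix (Fin k) (Fin l) R) :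
    Tendsto (fun n => moduleRank K (M n) A) ω (𝓝 (ultraRank (A.map (ultraRep K R M ω)))) :=
  tendsto_endMatRank (A.map fun r => fun n => Algebra.lsmul K K (M n) r)

/-- The ultraproduct representation takes values in a rank-preserving copy of von Neumann's
algebra. -/
theorem NearHyperfinite.exists_subalgebra {K R : Type*} [Field K] [Ring R] [Algebra K R]
    {M : ℕ → Type*} [∀ n, AddCommGroup (M n)] [∀ n, Module K (M n)] [∀ n, Module R (M n)]
    [∀ n, IsScalarTower K R (M n)] [∀ n, Module.Finite K (M n)]
    (h : NearHyperfinite fun n => act K R (M n)) {ω : Ultrafilter ℕ}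
    (hω : (ω : Filter ℕ) ≤ cofinite)
    (hd : Tendsto (fun n => Module.finrank K (M n)) ω atTop) :
    ∃ (S : Subalgebra K (ContUltraproduct K M ω)) (e : S ≃ₐ[K] VonNeumann K),
      (ultraRep K R M ω).range ≤ S ∧ ∀ (k l : ℕ) (A : Matrix (Fin k) (Fin l) S),
        ultraRank (A.map S.val) = vnRank (A.map e) := by
  obtain ⟨Φ, hinj, hmem, hrank⟩ := h.exists_vonNeumann_embedding hω hd
  let e := AlgEquiv.ofInjective Φ hinj
  refine ⟨Φ.range, e.symm, ?_, fun k l A => ?_⟩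
  · rintro _ ⟨r, rfl⟩
    exact hmem r
  · rw [← hrank]
    congr 1
    ext i j
    exact congrArg Subtype.val (e.apply_symm_apply (A i j)).symm

end RankSpectrum

end

theorem mainTheorem5 {K R : Type*} [Field K] [Finite K] [Ring R] [Algebra K R] [Module.Finite K R]
    (M : ℕ → Type*) [∀ n, AddCommGroup (M n)] [∀ n, Module K (M n)] [∀ n, Module R (M n)]
    [∀ n, IsScalarTower K R (M n)] [∀ n, Module.Finite K (M n)] [∀ n, Nontrivial (M n)]
    (hyper : RankSpectrum.Hyperfinite K R M) (conv : RankSpectrum.RankConvergent K R M) :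
    (∀ ω : Ultrafilter ℕ, (ω : Filter ℕ) ≤ cofinite →
      Tendsto (fun n => Module.finrank K (M n)) ω atTop →
      ∃ (S : Subalgebra K (RankSpectrum.ContUltraproduct K M ω))
        (e : S ≃ₐ[K] RankSpectrum.VonNeumann K),
        (RankSpectrum.ultraRep K R M ω).range ≤ S ∧
        ∀ (k l : ℕ) (A : Matrix (Fin k) (Fin l) S),
          RankSpectrum.ultraRank (A.map S.val) = RankSpectrum.vnRank (A.map e)) ∧
    ∃ ρ : R →ₐ[K] RankSpectrum.VonNeumann K, ∀ (k l : ℕ) (A : Matrix (Fin k) (Fin l) R),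
      Tendsto (fun n => RankSpectrum.moduleRank K (M n) A) atTop
        (𝓝 (RankSpectrum.vnRank (A.map ρ))) := by
  have h := hyper.nearHyperfinite
  refine ⟨fun ω hω hd => h.exists_subalgebra hω hd, ?_⟩
  -- Replacing `M n` by `n + 1` copies of itself does not change the ranks, and makes the
  -- dimensions tend to infinity, so that the first part applies along any ultrafilter.
  have hω : ((hyperfilter ℕ : Ultrafilter ℕ) : Filter ℕ) ≤ cofinite := hyperfilter_le_cofinite
  have hd : Tendsto (fun n => Module.finrank K (Fin (n + 1) → M n)) (hyperfilter ℕ) atTop := by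
    refine (tendsto_atTop_mono (fun n => ?_) tendsto_id).mono_left Nat.hyperfilter_le_atTop
    rw [RankSpectrum.finrank_tuple]
    exact (Nat.le_succ n).trans (Nat.le_mul_of_pos_right _ Module.finrank_pos)
  obtain ⟨S, e, hS, hrank⟩ := RankSpectrum.NearHyperfinite.exists_subalgebra
    (M := fun n => Fin (n + 1) → M n) (h.tuple fun n => n + 1) hω hd
  refine ⟨e.toAlgHom.comp ((RankSpectrum.ultraRep K R (fun n => Fin (n + 1) → M n)
    (hyperfilter ℕ)).codRestrict S fun r => hS ⟨r, rfl⟩), fun k l A => ?_⟩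
  obtain ⟨r, hr⟩ := conv k l A
  have h1 := RankSpectrum.tendsto_moduleRank (K := K) (fun n => Fin (n + 1) → M n)
    (hyperfilter ℕ) A
  simp only [RankSpectrum.moduleRank_tuple K (M _) (Nat.succ_pos _)] at h1
  rw [tendsto_nhds_unique (hr.mono_left Nat.hyperfilter_le_atTop) h1] at hr
  exact hrank k l (A.map ((RankSpectrum.ultraRep K R (fun n => Fin (n + 1) → M n)
    (hyperfilter ℕ)).codRestrict S fun r => hS ⟨r, rfl⟩)) ▸ hr
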